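/- Let $\mathbb{K}$ be a field of characteristic zero. **Definitions.** A double bialgebra $(B,m,\Delta,\delta)$ over $\mathbb{K}$ consists of two bialgebras $(B,m,\Delta)$ and $(B,m,\delta)$ with the same unital associative product $m$ and with counits $\varepsilon_\Delta$ and $\epsilon_\delta$, such that $(B,m,\Delta)$ is a bialgebra in the category of right $(B,m,\delta)$-comodules for the coaction $\delta$, i.e. $(\Delta\otimes \mathrm{Id})\circ\delta=m_{1,3,24}\circ(\delta\otimes\delta)\circ\Delta$ with $m_{1,3,24}(a\otimes b\otimes c\otimes d)=a\otimes c\otimes bd$, and $(\varepsilon_\Delta\otimes\mathrm{Id})\circ\delta(x)=\varepsilon_\Delta(x)1_B$. A double bialgebra morphism is a unital algebra morphism which is a coalgebra morphism for both coproducts. For $x\in\ker(\varepsilon_\Delta)$ put $\tilde\Delta(x)=\Delta(x)-x\otimes1-1\otimes x$, $\tilde\Delta^{(0)}=\mathrm{Id}$, $\tilde\Delta^{(n)}=(\tilde\Delta^{(n-1)}\otimes\mathrm{Id})\circ\tilde\Delta$. $B$ is *connected as a coalgebra* if $\ker(\varepsilon_\Delta)=\bigcup_{n\ge0}\ker\tilde\Delta^{(n)}$.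 For a commutative monoid $(M,+)$, $B$ is $M$-graded if $B=\bigoplus_{a\in M}B_a$ with $1_B\in B_0$, $B_aB_b\subseteq B_{a+b}$, $\Delta(B_a)\subseteq\sum_{b+c=a}B_b\otimes B_c$ and $\varepsilon_\Delta(B_a)=(0)$ for $a\ne0$; $\pi_a:B\to B_a$ denotes the projection. $\mathbb{K}[X]$ is a double bialgebra with $\Delta(X)=X\otimes1+1\otimes X$, $\delta(X)=X\otimes X$, $\varepsilon_\Delta(P)=P(0)$, $\epsilon_\delta(P)=P(1)$; put $H_n(X)=X(X-1)\cdots(X-n+1)/n!$. For a commutative semigroup $(\Omega,+)$, $\mathrm{QSh}(\mathbb{K}\Omega)$ has the words in the alphabet $\Omega$ as a basis, the quasishuffle product $\ast$ ($1\ast w=w\ast 1=w$ and $xv\ast yw=x(v\ast yw)+y(xv\ast w)+(x+y)(v\ast w)$ for letters $x,y$ and words $v,w$, the letter $x+y$ being the sum in $\Omega$), the deconcatenation coproduct $\Delta$, and the coproduct $\delta$ sending a word $w$ to the sum, over all ways to cut $w=w_1\cdots w_p$ into nonempty words, of $|w_1|\cdots|w_p|\otimes w_1\ast \cdots\ast w_p$,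 where the letter $|w_i|\in\Omega$ is the sum of the letters of $w_i$. Here $\varepsilon_\Delta(w)$ is $1$ if $w$ is the empty word and $0$ otherwise, and $\epsilon_\delta(w)$ is $1$ if $w$ has length $\le1$ and $0$ otherwise. $\mathbf{QSym}=\mathrm{QSh}(\mathbb{K}(\mathbb{N}_{>0},+))$. The degree of a word is the sum of its letters (the empty word has degree $0$), and a map into $\mathrm{QSh}(\mathbb{K}\Omega)$ is homogeneous if it sends $B_a$ into the span of the words of degree $a$, for every $a$. **Statement.** Let $(B,m,\Delta,\delta)$ be a double bialgebra over $\mathbb{K}$. 1. If $B$ is connected as a coalgebra, there is a unique double bialgebra morphism $\phi:B\to\mathbb{K}[X]$. For any $x\in\ker(\varepsilon_\Delta)$, $$\phi(x)=\sum_{n=1}^\infty\epsilon_\delta^{\otimes n}\circ\tilde\Delta^{(n-1)}(x)\,H_n(X),$$ the sum having finitely many nonzero terms. 2. If $B$ is $\mathbb{N}$-graded with $B_0=\mathbb{K}1_B$ and $\delta(B_n)\subseteq B_n\otimes B$ for any $n\in\mathbb{N}$, there is a unique homogeneous double bialgebra morphism $\phi:B\to\mathbf{QSym}$. For any $x\in\ker(\varepsilon_\Delta)$,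 $$\phi(x)=\sum_{n=1}^\infty\sum_{k_1,\dots,k_n\ge1}\epsilon_\delta^{\otimes n}\circ(\pi_{k_1}\otimes\cdots\otimes\pi_{k_n})\circ\tilde\Delta^{(n-1)}(x)\,(k_1,\dots,k_n).$$ 3. (a) Let $\Omega$ be a commutative semigroup and $u\Omega=\{0\}\sqcup\Omega$ the monoid obtained by adjoining a new neutral element $0$. If $B$ is $u\Omega$-graded with $B_0=\mathbb{K}1_B$, connected as a coalgebra, and $\delta(B_\alpha)\subseteq B_\alpha\otimes B$ for any $\alpha\in u\Omega$, there is a unique homogeneous double bialgebra morphism $\phi:B\to\mathrm{QSh}(\mathbb{K}\Omega)$ (degrees in $u\Omega$). For any $x\in\ker(\varepsilon_\Delta)$, $$\phi(x)=\sum_{n=1}^\infty\sum_{\alpha_1,\dots,\alpha_n\in\Omega}\epsilon_\delta^{\otimes n}\circ(\pi_{\alpha_1}\otimes\cdots\otimes\pi_{\alpha_n})\circ\tilde\Delta^{(n-1)}(x)\,(\alpha_1,\dots,\alpha_n).$$ (b) The same existence, uniqueness (degrees in $\Omega$) and formula hold if $\Omega$ is a commutative monoid and $B$ is $\Omega$-graded,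 connected as a coalgebra, with $\delta(B_\alpha)\subseteq B_\alpha\otimes B$ for any $\alpha\in\Omega$ (in particular if moreover the component of $B$ indexed by the unit of $\Omega$ is $\mathbb{K}1_B$). -/

import Mathlib

open scoped TensorProduct

noncomputable section

namespace DoubleBialg

universe u v w

/-! ### Double bialgebras -/

/-- Given a bialgebra `(B, m, Δ)` (Mathlib's structure on `B`), the data making it a double bialgebra
`(B, m, Δ, δ)`: a second coproduct `δ` with counit `ε_δ` such that `(B, m, δ)` is a bialgebra (first
five fields), and `(B, m, Δ)` is a bialgebra in the category of right `(B, m, δ)`-comodules for the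
coaction `δ` (last two fields; the unit and the product of `B` are comodule maps because `δ` is an
algebra map). -/
structure DoubleBialgebra (K : Type u) (B : Type v) [CommSemiring K] [Semiring B]
    [Bialgebra K B] where
  /-- the second coproduct `δ` -/
  delta : B →ₐ[K] B ⊗[K] B
  /-- the counit `ε_δ` of `δ` -/
  epsDelta : B →ₐ[K] K
  /-- `(δ ⊗ Id) ∘ δ = (Id ⊗ δ) ∘ δ` -/
  coassoc : (TensorProduct.assoc K B B B).toLinearMap ∘ₗ delta.toLinearMap.rTensor B ∘ₗ
    delta.toLinearMap = delta.toLinearMap.lTensor B ∘ₗ delta.toLinearMap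
  /-- `(ε_δ ⊗ Id) ∘ δ = Id` -/
  counit_left : ∀ x : B, epsDelta.toLinearMap.rTensor B (delta x) = 1 ⊗ₜ[K] x
  /-- `(Id ⊗ ε_δ) ∘ δ = Id` -/
  counit_right : ∀ x : B, epsDelta.toLinearMap.lTensor B (delta x) = x ⊗ₜ[K] 1
  /-- `(ε_Δ ⊗ Id) ∘ δ (x) = ε_Δ(x) 1_B` -/
  counit_coaction : ∀ x : B, (Coalgebra.counit (R := K) (A := B)).rTensor B (delta x) =
    Coalgebra.counit (R := K) x ⊗ₜ[K] 1
  /-- `(Δ ⊗ Id) ∘ δ = m_{1,3,24} ∘ (δ ⊗ δ) ∘ Δ`, where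
  `m_{1,3,24} (a ⊗ b ⊗ c ⊗ d) = a ⊗ c ⊗ b d` -/
  cointeraction : (Coalgebra.comul (R := K) (A := B)).rTensor B ∘ₗ delta.toLinearMap =
    (LinearMap.mul' K B).lTensor (B ⊗[K] B) ∘ₗ
      (TensorProduct.tensorTensorTensorComm K B B B B).toLinearMap ∘ₗ
        TensorProduct.map delta.toLinearMap delta.toLinearMap ∘ₗ
          Coalgebra.comul (R := K) (A := B)

/-- The six structure maps `(1, m, Δ, ε_Δ, δ, ε_δ)` of a double bialgebra, bundled only in order to
say what a morphism is. -/
structure StructureMaps (K : Type u) (A : Type v) [CommSemiring K] [AddCommMonoid A]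
    [Module K A] where
  one : A
  mul : A →ₗ[K] A →ₗ[K] A
  comul : A →ₗ[K] A ⊗[K] A
  counit : A →ₗ[K] K
  delta : A →ₗ[K] A ⊗[K] A
  epsDelta : A →ₗ[K] K

/-- The structure maps of a double bialgebra. -/
def DoubleBialgebra.maps {K : Type u} {B : Type v} [CommSemiring K] [Semiring B] [Bialgebra K B]
    (D : DoubleBialgebra K B) : StructureMaps K B where
  one := 1
  mul := LinearMap.mul K B
  comul := Coalgebra.comul
  counit := Coalgebra.counit
  delta := D.delta.toLinearMap
  epsDelta := D.epsDelta.toLinearMap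

/-- `φ` is a morphism of double bialgebras: a unital algebra map which is a (counital) coalgebra map
both for `Δ` and for `δ`. -/
structure IsDoubleBialgebraHom {K : Type u} {A : Type v} {A' : Type w} [CommSemiring K]
    [AddCommMonoid A] [Module K A] [AddCommMonoid A'] [Module K A']
    (S : StructureMaps K A) (T : StructureMaps K A') (φ : A →ₗ[K] A') : Prop where
  map_one : φ S.one = T.one
  map_mul : ∀ x y, φ (S.mul x y) = T.mul (φ x) (φ y)
  map_comul : T.comul ∘ₗ φ = TensorProduct.map φ φ ∘ₗ S.comul
  map_counit : T.counit ∘ₗ φ = S.counit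
  map_delta : T.delta ∘ₗ φ = TensorProduct.map φ φ ∘ₗ S.delta
  map_epsDelta : T.epsDelta ∘ₗ φ = S.epsDelta

/-! ### Reduced coproducts and connectedness -/

section Reduced

variable (K : Type u) (B : Type v) [CommRing K] [Ring B] [Bialgebra K B]

/-- `Δ̃(x) = Δ(x) - x ⊗ 1 - 1 ⊗ x`. It is used on `ker ε_Δ`, which it sends to
`ker ε_Δ ⊗ ker ε_Δ`. -/
def reducedComul : B →ₗ[K] B ⊗[K] B :=
  Coalgebra.comul - (TensorProduct.mk K B B).flip 1 - TensorProduct.mk K B B 1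

/-- The iterations `Δ̃⁽ⁿ⁾`, with values in the `(n+1)`-st tensor power of `B`: `Δ̃⁽⁰⁾ = Id` and
`Δ̃⁽ⁿ⁺¹⁾ = (Δ̃⁽ⁿ⁾ ⊗ Id) ∘ Δ̃`, with the canonical identifications `B = B^{⊗ 1}` and
`B^{⊗ (n+1)} ⊗ B^{⊗ 1} = B^{⊗ (n+2)}`. -/
def reducedComulIter : (n : ℕ) → B →ₗ[K] (⨂[K]^(n + 1) B)
  | 0 => (PiTensorProduct.subsingletonEquiv (R := K) (s := fun _ : Fin 1 => B) 0).symm.toLinearMap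
  | n + 1 =>
      (TensorPower.mulEquiv (R := K) (M := B) (n := n + 1) (m := 1)).toLinearMap ∘ₗ
        TensorProduct.map (reducedComulIter n)
          (PiTensorProduct.subsingletonEquiv (R := K) (s := fun _ : Fin 1 => B) 0).symm.toLinearMap ∘ₗ
          reducedComul K B

/-- Connectedness (as a coalgebra): `ker ε_Δ` is the union of the kernels of the `Δ̃⁽ⁿ⁾`. -/
def IsConnectedCoalgebra : Prop :=
  ∀ x : B, Coalgebra.counit (R := K) x = 0 → ∃ n : ℕ, reducedComulIter K B n x = 0

end Reduced

/-- The functional `f ⊗ ⋯ ⊗ f` on the `n`-th tensor power. -/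
def tensorPowFunctional {K : Type u} {B : Type v} [CommSemiring K] [AddCommMonoid B] [Module K B]
    (f : B →ₗ[K] K) (n : ℕ) : (⨂[K]^n B) →ₗ[K] K :=
  PiTensorProduct.lift
    ((MultilinearMap.mkPiAlgebra K (Fin n) K).compLinearMap fun _ => f)

/-! ### Graded double bialgebras -/

section Graded

variable {K : Type u} {B : Type v} {M : Type w} [CommRing K] [Ring B] [Bialgebra K B]

/-- The conditions which, on top of a grading of the algebra `B` by the monoid `M`, make `B` an
`M`-graded bialgebra: `Δ(B_a) ⊆ ⨁_{b + c = a} B_b ⊗ B_c`, and `ε_Δ(B_a) = 0` for `a ≠ 0`. -/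
structure IsGradedCoalgebra [AddMonoid M] (𝒜 : M → Submodule K B) : Prop where
  comul_mem : ∀ a, ∀ x ∈ 𝒜 a, Coalgebra.comul (R := K) x ∈
    ⨆ (p : M × M) (_ : p.1 + p.2 = a),
      LinearMap.range (TensorProduct.map (𝒜 p.1).subtype (𝒜 p.2).subtype)
  counit_eq_zero : ∀ a, a ≠ 0 → ∀ x ∈ 𝒜 a, Coalgebra.counit (R := K) x = 0

/-- `δ(B_a) ⊆ B_a ⊗ B` for every `a`. -/
def DoubleBialgebra.DeltaCompatible (D : DoubleBialgebra K B) (𝒜 : M → Submodule K B) : Prop :=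
  ∀ a, ∀ x ∈ 𝒜 a, D.delta x ∈ LinearMap.range ((𝒜 a).subtype.rTensor B)

/-- The scalar `ε_δ^{⊗ (n+1)} ∘ (π_{d 0} ⊗ ⋯ ⊗ π_{d n}) ∘ Δ̃⁽ⁿ⁾ (x)`, where `π_a` is the projection
of `B` onto `B_a`. -/
def DoubleBialgebra.gradedCoeff (D : DoubleBialgebra K B) [DecidableEq M] [AddMonoid M]
    (𝒜 : M → Submodule K B) [GradedAlgebra 𝒜] (n : ℕ) (d : Fin (n + 1) → M) (x : B) : K :=
  tensorPowFunctional D.epsDelta.toLinearMap (n + 1)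
    (PiTensorProduct.map (fun i => GradedAlgebra.proj 𝒜 (d i)) (reducedComulIter K B n x))

end Graded

/-! ### The double bialgebra `K[X]` -/

section Poly

open Polynomial

variable (K : Type u) [Field K]

/-- `K[X]` with `Δ(X) = X ⊗ 1 + 1 ⊗ X`, `δ(X) = X ⊗ X`, `ε_Δ(P) = P(0)`, `ε_δ(P) = P(1)`; both
coproducts are algebra maps. -/
def polyMaps : StructureMaps K K[X] where
  one := 1
  mul := LinearMap.mul K K[X]
  comul := (aeval ((X : K[X]) ⊗ₜ[K] (1 : K[X]) + (1 : K[X]) ⊗ₜ[K] (X : K[X]))).toLinearMap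
  counit := (aeval (0 : K)).toLinearMap
  delta := (aeval ((X : K[X]) ⊗ₜ[K] (X : K[X]))).toLinearMap
  epsDelta := (aeval (1 : K)).toLinearMap

/-- The Hilbert polynomial `H_n(X) = X (X - 1) ⋯ (X - n + 1) / n!`. -/
def hilbertPoly (n : ℕ) : K[X] :=
  C ((n.factorial : K)⁻¹) * ∏ i ∈ Finset.range n, (X - C (i : K))

end Poly

/-! ### Quasishuffle double bialgebras

For a commutative semigroup `(Ω, +)`, written additively, `QSh(KΩ)` is the tensor algebra of the
semigroup algebra `KΩ`; as a vector space it has the words in the alphabet `Ω` as a basis. The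
bialgebra `KΩ` has the coproduct `α ↦ α ⊗ α` and the counit `α ↦ 1`. -/

section QSh

/-- The vector space with basis the words in `Ω`. -/
abbrev QSh (K : Type u) (Ω : Type v) [Semiring K] : Type (max u v) := List Ω →₀ K

variable (K : Type u) (Ω : Type v) [Field K] [Add Ω]

variable {Ω} in
/-- The quasishuffle product of two words:
`xv ⧢ yw = x (v ⧢ yw) + y (xv ⧢ w) + (x + y) (v ⧢ w)`, the sum `x + y` being taken in `Ω`. -/
def qshWords : List Ω → List Ω → QSh K Ω
  | [], w => Finsupp.single w 1
  | x :: v, [] => Finsupp.single (x :: v) 1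
  | x :: v, y :: w =>
      (qshWords v (y :: w)).mapDomain (List.cons x) +
        (qshWords (x :: v) w).mapDomain (List.cons y) +
          (qshWords v w).mapDomain (List.cons (x + y))
  termination_by v w => v.length + w.length

/-- The quasishuffle product, extended bilinearly. -/
def qshMul : QSh K Ω →ₗ[K] QSh K Ω →ₗ[K] QSh K Ω :=
  Finsupp.linearCombination K fun v => Finsupp.linearCombination K fun w => qshWords K v w

variable {Ω} in
/-- All the ways of cutting a word into consecutive nonempty blocks; each block `u` is recorded as
the pair `(s, u)`, where `s` is the sum in `Ω` of the letters of `u`. -/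
def segmentations : List Ω → List (List (Ω × List Ω))
  | [] => [[]]
  | a :: w => (segmentations w).flatMap fun
      | [] => [[(a, [a])]]
      | (s, u) :: t => [(a, [a]) :: (s, u) :: t, (a + s, a :: u) :: t]

/-- The double bialgebra `QSh(KΩ)`: the product is the quasishuffle product, `Δ` is deconcatenation,
`δ` sends a word `w` to the sum, over all ways of cutting `w` into consecutive nonempty blocks, of
(the word of the sums of the blocks) `⊗` (the quasishuffle product of the blocks); `ε_Δ` is the
coefficient of the empty word, and `ε_δ` is `1` on words of length at most one and `0` on the
others. -/
def qshMaps : StructureMaps K (QSh K Ω) where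
  one := Finsupp.single [] 1
  mul := qshMul K Ω
  comul := Finsupp.linearCombination K fun w : List Ω =>
    ∑ i ∈ Finset.range (w.length + 1),
      (Finsupp.single (w.take i) 1 : QSh K Ω) ⊗ₜ[K] (Finsupp.single (w.drop i) 1 : QSh K Ω)
  counit := Finsupp.lapply []
  delta := Finsupp.linearCombination K fun w : List Ω =>
    ((segmentations w).map fun s =>
      (Finsupp.single (s.map Prod.fst) 1 : QSh K Ω) ⊗ₜ[K]
        (s.map Prod.snd).foldr (fun u r => qshMul K Ω (Finsupp.single u 1) r)
          (Finsupp.single [] 1)).sum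
  epsDelta := Finsupp.linearCombination K fun w : List Ω => if w.length ≤ 1 then 1 else 0

/-- The double bialgebra `QSym = QSh(K(ℕ_{>0}, +))` of quasisymmetric functions, in its basis of
monomial quasisymmetric functions, indexed by words (compositions) `(k₁, …, k_n)`. -/
abbrev QSym (K : Type u) [Semiring K] : Type u := QSh K ℕ+

/-- The structure maps of `QSym`. -/
abbrev qsymMaps : StructureMaps K (QSym K) := qshMaps K ℕ+

end QSh

/-- `φ : B → QSh(KΩ)` is homogeneous: `φ(B_m)` is contained in the span of the words of degree `m`,
where a letter `α` has degree `deg α` and the degree of a word is the sum of the degrees of its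
letters (`0` for the empty word). -/
def IsHomogeneousHom {K : Type u} {B : Type v} {Ω M : Type*} [Field K] [Ring B] [Algebra K B]
    [AddMonoid M] (deg : Ω → M) (𝒜 : M → Submodule K B) (φ : B →ₗ[K] QSh K Ω) : Prop :=
  ∀ m, ∀ x ∈ 𝒜 m, ∀ w ∈ (φ x).support, (w.map deg).sum = m

end DoubleBialg

end

open DoubleBialg

noncomputable section

namespace DoubleBialg

universe u v w

/-! With deconcatenation, `QSh K Ω` behaves as a cofree coalgebra. A counital coalgebra map into it
is determined by its one-letter part f : B → KΩ: the coefficient of the word α₁⋯αₙ is the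
convolution product f_{α₁} ⋆ ⋯ ⋆ f_{αₙ} (`apply_eq_wordFunctional`). Conversely any f for which
every element is killed by almost all of these functionals defines such a map, `cofreeLift`.

For a homogeneous double bialgebra morphism f is forced. It vanishes on 1, and on a homogeneous
element of ker ε_Δ of degree α only the letter α can occur, with coefficient read off by ε_δ. So f =
∑ (ε_δ ∘ π_α) α on ker ε_Δ, which is `letterMap`, and uniqueness follows. The explicit formula holds
because a convolution product of functionals vanishing on 1 is their tensor product evaluated on the
iterated reduced coproduct (`tensorFunctional_reducedComulIter`).

For existence, multiplicativity of ε_δ gives f(xy) = ε(y)f(x) + ε(x)f(y) + f(x)f(y); these three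
terms match the quasishuffle recursion (`letterMap_mul`, `cofreeLift_mul`). For δ, contract its left
factor with the coefficient of a word and induct on the word: the one-letter case uses the counit of
δ and δ(B_α) ⊆ B_α ⊗ B, and the inductive step is the cointeraction axiom (`sumProj_cofreeLift`,
`deltaCoeff_cofreeLift`).

All cases come from `exists_unique_hom_qsh`, where letters have degrees through an injective
additive map and ker ε_Δ has nothing in the other degrees. Convergence comes from connectedness, or
for `QSym` from the grading. For K[X], take a single letter: sending the word of length n to H_n
identifies `QSh K Unit` with K[X] (`isDoubleBialgebraHom_qshUnitEquiv`), as is checked by evaluation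
at natural numbers and Vandermonde's identity. -/

/-- Elements of a tensor product are separated by the first coordinate functions. -/
lemma eq_of_forall_lid_rTensor_lapply {K : Type u} {ι : Type v} {A : Type w} [Field K]
    [AddCommGroup A] [Module K A] {s t : (ι →₀ K) ⊗[K] A}
    (h : ∀ i, TensorProduct.lid K A ((Finsupp.lapply i).rTensor A s) =
      TensorProduct.lid K A ((Finsupp.lapply i).rTensor A t)) : s = t := by
  classical
  apply (TensorProduct.equivFinsuppOfBasisLeft (N := A)
    (Finsupp.basisSingleOne (R := K) (ι := ι))).injective
  ext1 i
  have key : ∀ s : (ι →₀ K) ⊗[K] A, TensorProduct.equivFinsuppOfBasisLeft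
      Finsupp.basisSingleOne s i = TensorProduct.lid K A ((Finsupp.lapply i).rTensor A s) := by
    intro s
    induction s with
    | zero => simp
    | tmul x y => simp
    | add x y hx hy => simp [hx, hy]
  rw [key, key, h]

/-- The functional taking the coefficient of `i ⊗ j`. -/
def tensorCoeff (K : Type u) {ι : Type v} {κ : Type w} [Field K] (i : ι) (j : κ) :
    (ι →₀ K) ⊗[K] (κ →₀ K) →ₗ[K] K :=
  LinearMap.mul' K K ∘ₗ TensorProduct.map (Finsupp.lapply i) (Finsupp.lapply j)

@[simp]
lemma tensorCoeff_tmul {K : Type u} {ι : Type v} {κ : Type w} [Field K] (i : ι) (j : κ)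
    (p : ι →₀ K) (q : κ →₀ K) : tensorCoeff K i j (p ⊗ₜ q) = p i * q j := by
  simp [tensorCoeff]

lemma tensorCoeff_map {K : Type u} {ι : Type v} {κ : Type w} {A B : Type*} [Field K]
    [AddCommGroup A] [Module K A] [AddCommGroup B] [Module K B] (i : ι) (j : κ)
    (f : A →ₗ[K] (ι →₀ K)) (g : B →ₗ[K] (κ →₀ K)) (t : A ⊗[K] B) :
    tensorCoeff K i j (TensorProduct.map f g t) = LinearMap.mul' K K
      (TensorProduct.map (Finsupp.lapply i ∘ₗ f) (Finsupp.lapply j ∘ₗ g) t) := by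
  rw [tensorCoeff, TensorProduct.map_comp]
  rfl

lemma eq_of_forall_tensorCoeff {K : Type u} {ι : Type v} {κ : Type w} [Field K]
    {s t : (ι →₀ K) ⊗[K] (κ →₀ K)} (h : ∀ i j, tensorCoeff K i j s = tensorCoeff K i j t) :
    s = t := by
  refine eq_of_forall_lid_rTensor_lapply fun i => Finsupp.ext fun j => ?_
  have key : ∀ s : (ι →₀ K) ⊗[K] (κ →₀ K), TensorProduct.lid K _
      ((Finsupp.lapply i).rTensor _ s) j = tensorCoeff K i j s := by
    intro s
    induction s with
    | zero => simp
    | tmul x y => simp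
    | add x y hx hy => simp only [map_add, Finsupp.add_apply, hx, hy]
  rw [key, key, h]

/-! ### Recursive descriptions of the product and of both coproducts of `QSh` -/

section QShCombinatorics

variable {K : Type u} {Ω : Type v} [Field K]

/-- Splitting off the first letter of a word; the empty word is sent to `0`. -/
def headTail (K : Type u) (Ω : Type v) [Field K] : QSh K Ω →ₗ[K] (Ω →₀ K) ⊗[K] QSh K Ω :=
  Finsupp.linearCombination K fun
    | [] => 0
    | a :: v => Finsupp.single a 1 ⊗ₜ[K] Finsupp.single v 1

@[simp]
lemma headTail_single_nil (c : K) : headTail K Ω (Finsupp.single [] c) = 0 := by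
  simp [headTail]

@[simp]
lemma headTail_single_cons (a : Ω) (v : List Ω) (c : K) :
    headTail K Ω (Finsupp.single (a :: v) c) = Finsupp.single a 1 ⊗ₜ Finsupp.single v c := by
  simp only [headTail, Finsupp.linearCombination_single, ← TensorProduct.tmul_smul,
    Finsupp.smul_single, smul_eq_mul, mul_one]

lemma headTail_mapDomain_cons (a : Ω) (p : QSh K Ω) :
    headTail K Ω (p.mapDomain (List.cons a)) = Finsupp.single a 1 ⊗ₜ p := by
  induction p using Finsupp.induction_linear with
  | zero => simp
  | add p q hp hq => simp [Finsupp.mapDomain_add, hp, hq, TensorProduct.tmul_add]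
  | single v c => simp [Finsupp.mapDomain_single]

lemma tensorCoeff_headTail (a : Ω) (w : List Ω) (p : QSh K Ω) :
    tensorCoeff K a w (headTail K Ω p) = p (a :: w) := by
  classical
  induction p using Finsupp.induction_linear with
  | zero => simp
  | add p q hp hq => simp [hp, hq]
  | single v c =>
    cases v with
    | nil => simp
    | cons b v => by_cases h : b = a <;> by_cases h' : v = w <;> simp [h, h']

/-- The product of letters, extended bilinearly. -/
def letterMul (K : Type u) (Ω : Type v) [Field K] [Add Ω] :
    (Ω →₀ K) →ₗ[K] (Ω →₀ K) →ₗ[K] (Ω →₀ K) :=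
  Finsupp.linearCombination K fun a => Finsupp.linearCombination K fun b =>
    Finsupp.single (a + b) 1

variable [Add Ω]

@[simp]
lemma letterMul_single (a b : Ω) (c d : K) :
    letterMul K Ω (Finsupp.single a c) (Finsupp.single b d) = Finsupp.single (a + b) (c * d) := by
  simp [letterMul]

lemma qshWords_nil_right (v : List Ω) : qshWords K v [] = Finsupp.single v 1 := by
  cases v <;> simp [qshWords]

lemma qshMul_single (v w : List Ω) (c d : K) :
    qshMul K Ω (Finsupp.single v c) (Finsupp.single w d) = (c * d) • qshWords K v w := by
  simp [qshMul, smul_smul]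

/-- The product of letters tensored with the quasishuffle product. -/
def headTailMul (K : Type u) (Ω : Type v) [Field K] [Add Ω] :
    ((Ω →₀ K) ⊗[K] QSh K Ω) →ₗ[K] ((Ω →₀ K) ⊗[K] QSh K Ω) →ₗ[K] ((Ω →₀ K) ⊗[K] QSh K Ω) :=
  TensorProduct.curry (TensorProduct.map (TensorProduct.lift (letterMul K Ω))
      (TensorProduct.lift (qshMul K Ω)) ∘ₗ
    (TensorProduct.tensorTensorTensorComm K _ _ _ _).toLinearMap)

@[simp]
lemma headTailMul_tmul (p p' : Ω →₀ K) (q q' : QSh K Ω) :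
    headTailMul K Ω (p ⊗ₜ q) (p' ⊗ₜ q') = letterMul K Ω p p' ⊗ₜ qshMul K Ω q q' := by
  simp [headTailMul]

/-- The recursive definition of the quasishuffle product, in a form valid for all elements. -/
lemma headTail_qshMul (p q : QSh K Ω) :
    headTail K Ω (qshMul K Ω p q) =
      ((qshMul K Ω).flip q).lTensor _ (headTail K Ω p) +
      (qshMul K Ω p).lTensor _ (headTail K Ω q) +
      headTailMul K Ω (headTail K Ω p) (headTail K Ω q) := by
  induction p using Finsupp.induction_linear with
  | zero => simp
  | add p p' hp hp' =>
    simp only [map_add, LinearMap.add_apply, hp, hp', LinearMap.lTensor_add]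
    abel
  | single v c =>
  induction q using Finsupp.induction_linear with
  | zero => simp
  | add q q' hq hq' =>
    simp only [map_add, LinearMap.add_apply, hq, hq', LinearMap.lTensor_add]
    abel
  | single w d =>
    rcases v with _ | ⟨a, v⟩ <;> rcases w with _ | ⟨b, w⟩
    · simp only [qshMul_single, qshWords, map_smul, headTail_single_nil, map_zero, smul_zero,
        add_zero]
    · simp only [qshMul_single, qshWords, map_smul, headTail_single_nil, map_zero,
        LinearMap.zero_apply, add_zero, zero_add, headTail_single_cons, LinearMap.lTensor_tmul,
        TensorProduct.tmul_smul]
    · simp only [qshMul_single, qshWords_nil_right, map_smul, headTail_single_nil,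
        map_zero, add_zero, headTail_single_cons, LinearMap.lTensor_tmul,
        LinearMap.flip_apply, TensorProduct.tmul_smul]
    · simp only [qshMul_single, qshWords, smul_add, map_add, map_smul, headTail_mapDomain_cons,
        headTail_single_cons, LinearMap.lTensor_tmul, LinearMap.flip_apply, headTailMul_tmul,
        letterMul_single, TensorProduct.tmul_smul, mul_one]

/-- Every term of the recursion for two nonempty words begins with a letter, so only the product of
two empty words contributes. -/
lemma qshMul_apply_nil (p q : QSh K Ω) : qshMul K Ω p q [] = p [] * q [] := by
  induction p using Finsupp.induction_linear with
  | zero => simp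
  | add p p' hp hp' => simp [hp, hp', add_mul]
  | single v c =>
  induction q using Finsupp.induction_linear with
  | zero => simp
  | add q q' hq hq' => simp only [map_add, Finsupp.add_apply, hq, hq', mul_add]
  | single w d =>
    have key : ∀ (a : Ω) (p : QSh K Ω), (p.mapDomain (List.cons a)) [] = 0 := fun a p =>
      Finsupp.mapDomain_of_notMem_range _ _ (by simp)
    rcases v with _ | ⟨a, v⟩ <;> rcases w with _ | ⟨b, w⟩ <;>
      simp [qshMul_single, qshWords, key]

/-! #### The coproduct `Δ` -/

lemma qsh_comul_single_nil :
    (qshMaps K Ω).comul (Finsupp.single [] 1) =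
      (Finsupp.single [] 1 : QSh K Ω) ⊗ₜ[K] (Finsupp.single [] 1 : QSh K Ω) := by
  simp [qshMaps]

lemma qsh_comul_single_cons (a : Ω) (v : List Ω) :
    (qshMaps K Ω).comul (Finsupp.single (a :: v) 1) =
      (Finsupp.single [] 1 : QSh K Ω) ⊗ₜ[K] (Finsupp.single (a :: v) 1 : QSh K Ω) +
      ∑ i ∈ Finset.range (v.length + 1), (Finsupp.single (a :: v.take i) 1 : QSh K Ω) ⊗ₜ[K]
        (Finsupp.single (v.drop i) 1 : QSh K Ω) := by
  simp only [qshMaps, Finsupp.linearCombination_single, one_smul, List.length_cons]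
  rw [Finset.sum_range_succ' _ (v.length + 1), add_comm]
  simp

/-- The pairing of `Δ(p)` with two words. -/
lemma qsh_comul_coeff (v w : List Ω) (p : QSh K Ω) :
    tensorCoeff K v w ((qshMaps K Ω).comul p) = p (v ++ w) := by
  classical
  induction p using Finsupp.induction_linear with
  | zero => simp
  | add p p' hp hp' => simp only [map_add, Finsupp.add_apply, hp, hp']
  | single z c =>
    simp only [qshMaps, Finsupp.linearCombination_single, map_smul, map_sum,
      tensorCoeff_tmul, smul_eq_mul]
    by_cases h : z = v ++ w
    · subst h
      rw [Finset.sum_eq_single v.length]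
      · simp
      · intro i hi hne
        rw [Finsupp.single_apply, if_neg, zero_mul]
        intro h
        apply hne
        rw [← h, List.length_take]
        simp at hi ⊢
        omega
      · simp
    · rw [Finset.sum_eq_zero, Finsupp.single_apply, if_neg h, mul_zero]
      intro i _
      simp only [Finsupp.single_apply]
      split_ifs with h1 h2 <;> simp
      exact h (by rw [← h1, ← h2, List.take_append_drop])

/-! #### The coproduct `δ` -/

/-- The sum in `Ω` of the letters of the nonempty word `a :: w`. -/
def letterSum (a : Ω) : List Ω → Ω
  | [] => a
  | b :: w => a + letterSum b w

/-- Adding a letter to the first block of a segmentation, and evaluating a function `g`. -/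
def extendFirstBlock {A : Type*} [Zero A] (a : Ω) (g : List (Ω × List Ω) → A) :
    List (Ω × List Ω) → A
  | [] => 0
  | (s, u) :: t => g ((a + s, a :: u) :: t)

/-- The first letter either forms a block alone or joins the first block of a segmentation of the
rest. The second option does not exist for the empty segmentation, whence the value 0 in
`extendFirstBlock`. -/
lemma sum_segmentations_succ {A : Type*} [AddCommMonoid A] (v : List Ω) (a : Ω)
    (g : List (Ω × List Ω) → A) :
    ((segmentations (a :: v)).map g).sum =
      ((segmentations v).map fun t => g ((a, [a]) :: t)).sum +
        ((segmentations v).map (extendFirstBlock a g)).sum := by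
  rw [segmentations]
  generalize segmentations v = l
  induction l with
  | nil => simp
  | cons t l ih =>
    rw [List.flatMap_cons, List.map_append, List.sum_append, ih]
    rcases t with _ | ⟨⟨s, u⟩, t⟩
    · simp [extendFirstBlock, add_assoc]
    · simp [extendFirstBlock]
      abel

/-- Sums over the segmentations of a nonempty word, organised according to the first block. -/
lemma sum_segmentations_cons {A : Type*} [AddCommMonoid A] (v : List Ω) (a : Ω)
    (g : List (Ω × List Ω) → A) :
    ((segmentations (a :: v)).map g).sum = ∑ i ∈ Finset.range (v.length + 1),
      ((segmentations (v.drop i)).map fun t =>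
        g ((letterSum a (v.take i), a :: v.take i) :: t)).sum := by
  induction v generalizing a g with
  | nil => simp [segmentations, letterSum]
  | cons b v ih =>
    rw [sum_segmentations_succ, ih b (extendFirstBlock a g), List.length_cons,
      Finset.sum_range_succ' _ (v.length + 1), add_comm]
    simp [letterSum, extendFirstBlock]

/-- The quasishuffle product of the blocks of a segmentation. -/
def blockProd (K : Type u) {Ω : Type v} [Field K] [Add Ω] (s : List (Ω × List Ω)) : QSh K Ω :=
  (s.map Prod.snd).foldr (fun u r => qshMul K Ω (Finsupp.single u 1) r) (Finsupp.single [] 1)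

/-- `(χ ⊗ Id) ∘ δ`, for a functional `χ` given by its values on words. -/
def deltaContract (χ : List Ω → K) : QSh K Ω →ₗ[K] QSh K Ω :=
  Finsupp.linearCombination K fun v : List Ω =>
    ((segmentations v).map fun s => χ (s.map Prod.fst) • blockProd K s).sum

lemma lid_rTensor_delta (χ : List Ω → K) (p : QSh K Ω) :
    TensorProduct.lid K _ ((Finsupp.linearCombination K χ).rTensor _ ((qshMaps K Ω).delta p)) =
      deltaContract χ p := by
  induction p using Finsupp.induction_linear with
  | zero => simp
  | add p p' hp hp' => simp only [map_add, hp, hp']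
  | single z c =>
    simp only [qshMaps, deltaContract, Finsupp.linearCombination_single, map_smul, map_list_sum,
      List.map_map]
    congr 3
    ext1 s
    simp [blockProd]

lemma deltaContract_single_nil (χ : List Ω → K) (c : K) :
    deltaContract χ (Finsupp.single [] c) = Finsupp.single [] (c * χ []) := by
  simp [deltaContract, segmentations, blockProd]

/-- Isolating the first block makes δ recursive: the block contributes a left factor to the product,
and its letter is absorbed into the functional applied to the remaining blocks. -/
lemma deltaContract_single_cons (χ : List Ω → K) (a : Ω) (v : List Ω) :
    deltaContract χ (Finsupp.single (a :: v) 1) =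
      ∑ i ∈ Finset.range (v.length + 1), qshMul K Ω (Finsupp.single (a :: v.take i) 1)
        (deltaContract (fun t => χ (letterSum a (v.take i) :: t))
          (Finsupp.single (v.drop i) 1)) := by
  simp only [deltaContract, Finsupp.linearCombination_single, one_smul, sum_segmentations_cons]
  refine Finset.sum_congr rfl fun i _ => ?_
  rw [map_list_sum, List.map_map]
  congr 2
  ext1 t
  simp [blockProd]

open Classical in
/-- The projection on the span of the nonempty words with a given sum of letters. -/
def sumProj (K : Type u) {Ω : Type v} [Field K] [Add Ω] (α : Ω) : QSh K Ω →ₗ[K] QSh K Ω :=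
  Finsupp.linearCombination K fun
    | [] => 0
    | a :: v => if letterSum a v = α then Finsupp.single (a :: v) 1 else 0

open Classical in
/-- `(e_w ⊗ Id) ∘ δ`, where `e_w` is the coefficient of the word `w`. -/
def deltaCoeff (K : Type u) {Ω : Type v} [Field K] [Add Ω] (w : List Ω) :
    QSh K Ω →ₗ[K] QSh K Ω :=
  deltaContract fun v => if v = w then 1 else 0

lemma lid_rTensor_lapply_delta (w : List Ω) (p : QSh K Ω) :
    TensorProduct.lid K _ ((Finsupp.lapply w).rTensor _ ((qshMaps K Ω).delta p)) =
      deltaCoeff K w p := by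
  classical
  rw [deltaCoeff, ← lid_rTensor_delta]
  congr 3
  ext v
  simp [Finsupp.single_apply]

lemma deltaCoeff_nil (p : QSh K Ω) : deltaCoeff K [] p = Finsupp.single [] (p []) := by
  induction p using Finsupp.induction_linear with
  | zero => simp
  | add p p' hp hp' => simp only [map_add, hp, hp', Finsupp.add_apply, Finsupp.single_add]
  | single z c =>
    rcases z with _ | ⟨a, v⟩
    · simp [deltaCoeff, deltaContract_single_nil]
    · rw [← mul_one c, ← smul_eq_mul, ← Finsupp.smul_single, map_smul, deltaCoeff,
        deltaContract_single_cons]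
      simp only [reduceCtorEq, if_false]
      simp [deltaContract]

/-- The compatibility of `δ` with the deconcatenation coproduct. -/
lemma deltaCoeff_cons (α : Ω) (w : List Ω) (p : QSh K Ω) :
    deltaCoeff K (α :: w) p = TensorProduct.lift (qshMul K Ω)
      (TensorProduct.map (sumProj K α) (deltaCoeff K w) ((qshMaps K Ω).comul p)) := by
  classical
  induction p using Finsupp.induction_linear with
  | zero => simp
  | add p p' hp hp' => simp only [map_add, hp, hp']
  | single z c =>
    rw [← mul_one c, ← smul_eq_mul, ← Finsupp.smul_single]
    simp only [map_smul]
    congr 1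
    rcases z with _ | ⟨a, v⟩
    · rw [qsh_comul_single_nil]
      simp [deltaCoeff, deltaContract_single_nil, sumProj]
    · rw [qsh_comul_single_cons, deltaCoeff, deltaContract_single_cons]
      simp only [map_add, map_sum, TensorProduct.map_tmul, TensorProduct.lift.tmul]
      simp only [sumProj, Finsupp.linearCombination_single, one_smul, smul_zero, map_zero,
        LinearMap.zero_apply, zero_add]
      refine Finset.sum_congr rfl fun i _ => ?_
      split_ifs with h
      · simp [h, deltaCoeff]
      · simp [h, deltaContract]

end QShCombinatorics

/-! ### Maps into the tensor coalgebra -/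

section Cofree

open Coalgebra WithConv

variable {K : Type u} {B : Type v} {Ω : Type w} [Field K] [Ring B] [Bialgebra K B]

/-- The functional `f_{α₁} ⋆ ⋯ ⋆ f_{αₙ}` attached to the word `α₁ ⋯ αₙ`, where `f_α` is the
coordinate of index `α` of `f` and `⋆` is the convolution product. -/
def wordFunctional (f : B →ₗ[K] (Ω →₀ K)) (w : List Ω) : WithConv (B →ₗ[K] K) :=
  (w.map fun a => toConv (Finsupp.lapply a ∘ₗ f)).prod

variable (f : B →ₗ[K] (Ω →₀ K))

lemma wordFunctional_nil_apply (x : B) :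
    (wordFunctional f []).ofConv x = counit (R := K) x := by
  simp [wordFunctional, LinearMap.convOne_def]

lemma wordFunctional_cons_apply (a : Ω) (w : List Ω) (x : B) :
    (wordFunctional f (a :: w)).ofConv x = LinearMap.mul' K K
      (TensorProduct.map (Finsupp.lapply a ∘ₗ f) (wordFunctional f w).ofConv (comul x)) := by
  simp [wordFunctional, LinearMap.convMul_def]

lemma wordFunctional_append (v w : List Ω) :
    wordFunctional f (v ++ w) = wordFunctional f v * wordFunctional f w := by
  simp [wordFunctional]

lemma wordFunctional_singleton (a : Ω) :
    wordFunctional f [a] = toConv (Finsupp.lapply a ∘ₗ f) := by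
  simp [wordFunctional]

/-- Δ(x) is a finite sum of simple tensors, and f of each left factor has finite support; this
leaves finitely many first letters, and induction handles the right factors. -/
lemma finite_length_eq_wordFunctional_ne_zero (n : ℕ) (x : B) :
    {w : List Ω | w.length = n ∧ (wordFunctional f w).ofConv x ≠ 0}.Finite := by
  induction n generalizing x with
  | zero => exact (Set.finite_singleton []).subset fun w hw => List.length_eq_zero_iff.1 hw.1
  | succ n ih =>
    let 𝓡 := ℛ K x
    refine (𝓡.index.finite_toSet.biUnion fun i _ =>
      ((f (𝓡.left i)).support.finite_toSet).image2 List.cons (ih (𝓡.right i))).subset ?_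
    rintro (_ | ⟨a, w⟩) ⟨hw, hne⟩
    · simp at hw
    · rw [wordFunctional_cons_apply, ← 𝓡.eq] at hne
      simp only [map_sum, TensorProduct.map_tmul, LinearMap.mul'_apply] at hne
      obtain ⟨i, hi, hi'⟩ := Finset.exists_ne_zero_of_sum_ne_zero hne
      simp only [Set.mem_iUnion]
      refine ⟨i, hi, Set.mem_image2.2 ⟨a, ?_, w,
        ⟨by simpa using hw, right_ne_zero_of_mul hi'⟩, rfl⟩⟩
      simpa using left_ne_zero_of_mul hi'

/-- Every element is killed by all but finitely many of the functionals attached to words. -/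
def IsFinitary : Prop := ∀ x : B, {w : List Ω | (wordFunctional f w).ofConv x ≠ 0}.Finite

variable {f} in
lemma IsFinitary.of_length
    (h : ∀ x : B, ∃ N, ∀ w : List Ω, N ≤ w.length → (wordFunctional f w).ofConv x = 0) :
    IsFinitary f := by
  intro x
  obtain ⟨N, hN⟩ := h x
  refine ((Finset.range N).finite_toSet.biUnion fun n _ =>
    finite_length_eq_wordFunctional_ne_zero f n x).subset fun w hw => ?_
  simp only [Set.mem_iUnion]
  exact ⟨w.length, by simpa using lt_of_not_ge fun hle => hw (hN w hle), rfl, hw⟩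

variable {f} (hf : IsFinitary f)

/-- The map into the tensor coalgebra induced by `f`. -/
def cofreeLift : B →ₗ[K] QSh K Ω where
  toFun x := Finsupp.ofSupportFinite (fun w => (wordFunctional f w).ofConv x) (hf x)
  map_add' x y := Finsupp.ext fun w => map_add (wordFunctional f w).ofConv x y
  map_smul' c x := Finsupp.ext fun w => map_smul (wordFunctional f w).ofConv c x

lemma cofreeLift_apply (x : B) (w : List Ω) :
    cofreeLift hf x w = (wordFunctional f w).ofConv x := rfl

lemma lapply_comp_cofreeLift (w : List Ω) :
    Finsupp.lapply w ∘ₗ cofreeLift hf = (wordFunctional f w).ofConv := rfl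

lemma cofreeLift_apply_nil (x : B) : cofreeLift hf x [] = counit (R := K) x := by
  rw [cofreeLift_apply, wordFunctional_nil_apply]

lemma cofreeLift_apply_singleton (x : B) (a : Ω) : cofreeLift hf x [a] = f x a := by
  rw [cofreeLift_apply, wordFunctional_singleton]
  rfl

/-- Removing the first letter of a word corresponds to removing the first convolution factor. This
lets the head-tail form of the quasishuffle product be compared with Δ. -/
lemma headTail_cofreeLift (x : B) :
    headTail K Ω (cofreeLift hf x) = TensorProduct.map f (cofreeLift hf) (comul x) := by
  refine eq_of_forall_tensorCoeff fun a w => ?_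
  rw [tensorCoeff_headTail, cofreeLift_apply, wordFunctional_cons_apply, tensorCoeff_map,
    lapply_comp_cofreeLift]

lemma wordFunctional_one (hf1 : f 1 = 0) (a : Ω) (w : List Ω) :
    (wordFunctional f (a :: w)).ofConv 1 = 0 := by
  rw [wordFunctional_cons_apply, Bialgebra.comul_one, Algebra.TensorProduct.one_def]
  simp [hf1]

lemma cofreeLift_one (hf1 : f 1 = 0) : cofreeLift hf 1 = Finsupp.single [] 1 := by
  ext w
  rcases w with _ | ⟨a, w⟩
  · simp [cofreeLift_apply_nil]
  · rw [cofreeLift_apply, wordFunctional_one hf1]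
    simp

variable [Add Ω]

/-- Concatenation of words becomes convolution of functionals, which is dual to deconcatenation. -/
lemma cofreeLift_comul (x : B) : (qshMaps K Ω).comul (cofreeLift hf x) =
    TensorProduct.map (cofreeLift hf) (cofreeLift hf) (comul x) := by
  refine eq_of_forall_tensorCoeff fun v w => ?_
  rw [qsh_comul_coeff, cofreeLift_apply, wordFunctional_append, tensorCoeff_map,
    lapply_comp_cofreeLift, lapply_comp_cofreeLift]
  rfl

/-- Induction on the word whose coefficient is compared. Since Δ is multiplicative, the three terms
of `hmul` for the first letter yield the three terms of `headTail_qshMul`. -/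
lemma cofreeLift_mul (hmul : ∀ x y, f (x * y) =
      counit (R := K) y • f x + counit (R := K) x • f y + letterMul K Ω (f x) (f y)) (x y : B) :
    cofreeLift hf (x * y) = qshMul K Ω (cofreeLift hf x) (cofreeLift hf y) := by
  ext w
  induction w generalizing x y with
  | nil => simp [cofreeLift_apply_nil, qshMul_apply_nil]
  | cons a w ih =>
    rw [← tensorCoeff_headTail a w, ← tensorCoeff_headTail a w, headTail_qshMul,
      headTail_cofreeLift, headTail_cofreeLift, headTail_cofreeLift, Bialgebra.comul_mul]
    let 𝓡 := ℛ K x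
    let 𝓢 := ℛ K y
    -- The counit axiom rewrites the undivided factors, so that all terms become double sums over
    -- the same simple tensors of Δ(x) and Δ(y).
    have hx : cofreeLift hf x =
        ∑ i ∈ 𝓡.index, counit (R := K) (𝓡.left i) • cofreeLift hf (𝓡.right i) := by
      conv_lhs => rw [← sum_counit_smul 𝓡]
      simp
    have hy : cofreeLift hf y =
        ∑ i ∈ 𝓢.index, counit (R := K) (𝓢.left i) • cofreeLift hf (𝓢.right i) := by
      conv_lhs => rw [← sum_counit_smul 𝓢]
      simp
    rw [hx, hy, ← 𝓡.eq, ← 𝓢.eq]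
    simp only [map_sum, map_add, TensorProduct.tmul_sum, TensorProduct.tmul_smul,
      Finset.sum_mul, Finset.mul_sum, TensorProduct.map_tmul,
      Algebra.TensorProduct.tmul_mul_tmul, tensorCoeff_tmul, ih, hmul, LinearMap.lTensor_tmul,
      headTailMul_tmul, Finsupp.add_apply, Finsupp.smul_apply, map_smul, LinearMap.flip_apply,
      LinearMap.sum_apply, LinearMap.smul_apply, smul_eq_mul,
      Finset.sum_comm (s := 𝓢.index) (t := 𝓡.index)]
    rw [← Finset.sum_add_distrib, ← Finset.sum_add_distrib]
    refine Finset.sum_congr rfl fun i _ => ?_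
    rw [← Finset.sum_add_distrib, ← Finset.sum_add_distrib]
    refine Finset.sum_congr rfl fun j _ => ?_
    ring

/-- A coalgebra map into the tensor coalgebra is determined by its components of length one. -/
lemma apply_eq_wordFunctional {ψ : B →ₗ[K] QSh K Ω}
    (hcomul : (qshMaps K Ω).comul ∘ₗ ψ = TensorProduct.map ψ ψ ∘ₗ comul)
    (hcounit : (qshMaps K Ω).counit ∘ₗ ψ = counit) (hψ : ∀ x a, ψ x [a] = f x a)
    (x : B) (w : List Ω) : ψ x w = (wordFunctional f w).ofConv x := by
  induction w generalizing x with
  | nil => rw [wordFunctional_nil_apply, ← hcounit]; rfl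
  | cons a w ih =>
    have h1 : Finsupp.lapply [a] ∘ₗ ψ = Finsupp.lapply a ∘ₗ f := LinearMap.ext fun x => hψ x a
    have h2 : Finsupp.lapply w ∘ₗ ψ = (wordFunctional f w).ofConv := LinearMap.ext fun x => ih x
    rw [wordFunctional_cons_apply, ← h1, ← h2, ← tensorCoeff_map,
      ← LinearMap.comp_apply (TensorProduct.map ψ ψ), ← hcomul, LinearMap.comp_apply,
      qsh_comul_coeff]
    rfl

end Cofree

/-! ### Iterated reduced coproducts as convolution products -/

section Reduced

open Coalgebra WithConv

variable {K : Type u} {B : Type v} [Field K] [Ring B] [Bialgebra K B]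

/-- The projection `x ↦ x - ε(x) 1` on the kernel of the counit. -/
def kerProj (K : Type u) (B : Type v) [Field K] [Ring B] [Bialgebra K B] : B →ₗ[K] B :=
  LinearMap.id - Algebra.linearMap K B ∘ₗ counit

lemma kerProj_apply (x : B) : kerProj K B x = x - counit (R := K) x • (1 : B) := by
  simp [kerProj, Algebra.algebraMap_eq_smul_one]

lemma kerProj_one : kerProj K B 1 = 0 := by simp [kerProj_apply]

lemma kerProj_of_counit_eq_zero {x : B} (hx : counit (R := K) x = 0) : kerProj K B x = x := by
  simp [kerProj_apply, hx]

lemma counit_kerProj (x : B) : counit (R := K) (kerProj K B x) = 0 := by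
  simp [kerProj_apply]

lemma comp_kerProj {V : Type*} [AddCommGroup V] [Module K V] {g : B →ₗ[K] V} (hg : g 1 = 0) :
    g ∘ₗ kerProj K B = g := by
  ext x
  simp [kerProj_apply, hg]

lemma conv_mul_one (g h : WithConv (B →ₗ[K] K)) :
    (g * h).ofConv 1 = g.ofConv 1 * h.ofConv 1 := by
  simp [LinearMap.convMul_def, Algebra.TensorProduct.one_def]

lemma conv_prod_one {l : List (WithConv (B →ₗ[K] K))} (hne : l ≠ [])
    (hl : ∀ g ∈ l, g.ofConv 1 = 0) : l.prod.ofConv 1 = 0 := by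
  obtain _ | ⟨g, l⟩ := l
  · simp at hne
  · rw [List.prod_cons, conv_mul_one, hl g (by simp), zero_mul]

/-- In the expansion of (Id − ε1) ⊗ (Id − ε1) on Δ(x), the counit axioms turn the mixed terms into x
⊗ 1 and 1 ⊗ x, while the last term is ε(x) 1 ⊗ 1 = 0. -/
lemma map_kerProj_comul {x : B} (hx : counit (R := K) x = 0) :
    TensorProduct.map (kerProj K B) (kerProj K B) (comul (R := K) x) = reducedComul K B x := by
  let 𝓡 := ℛ K x
  have h1 : ∑ i ∈ 𝓡.index, counit (R := K) (𝓡.left i) • 𝓡.right i = x := sum_counit_smul 𝓡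
  have h2 : ∑ i ∈ 𝓡.index, counit (R := K) (𝓡.right i) • 𝓡.left i = x := by
    have := congr(TensorProduct.rid K B $(sum_tmul_counit_eq 𝓡))
    simpa only [map_sum, TensorProduct.rid_tmul, one_smul] using this
  have h3 : ∑ i ∈ 𝓡.index, counit (R := K) (𝓡.left i) * counit (R := K) (𝓡.right i) = 0 := by
    have := congr(counit (R := K) $h1)
    simpa [hx] using this
  simp only [reducedComul, LinearMap.sub_apply, LinearMap.flip_apply, TensorProduct.mk_apply]
  conv_lhs => rw [← 𝓡.eq]
  conv_rhs => rw [← 𝓡.eq]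
  have e1 : ∑ i ∈ 𝓡.index, 𝓡.left i ⊗ₜ[K] (counit (R := K) (𝓡.right i) • (1 : B)) =
      x ⊗ₜ[K] (1 : B) := by
    conv_rhs => rw [← h2]
    simp [TensorProduct.sum_tmul, TensorProduct.smul_tmul]
  have e2 : ∑ i ∈ 𝓡.index, (counit (R := K) (𝓡.left i) • (1 : B)) ⊗ₜ[K] 𝓡.right i =
      (1 : B) ⊗ₜ[K] x := by
    conv_rhs => rw [← h1]
    simp [TensorProduct.tmul_sum, TensorProduct.smul_tmul]
  have e3 : ∑ i ∈ 𝓡.index, (counit (R := K) (𝓡.left i) • (1 : B)) ⊗ₜ[K]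
      (counit (R := K) (𝓡.right i) • (1 : B)) = 0 := by
    rw [← zero_smul K ((1 : B) ⊗ₜ[K] (1 : B)), ← h3, Finset.sum_smul]
    refine Finset.sum_congr rfl fun i _ => ?_
    rw [← TensorProduct.smul_tmul', TensorProduct.tmul_smul, smul_smul]
  rw [← e1, ← e2, ← sub_zero (_ - _), ← neg_zero, ← e3]
  simp only [map_sum, TensorProduct.map_tmul, kerProj_apply, TensorProduct.sub_tmul,
    TensorProduct.tmul_sub, Finset.sum_sub_distrib]
  abel

/-- The functional `r₁ ⊗ ⋯ ⊗ rₙ` on the `n`-th tensor power. -/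
def tensorFunctional {n : ℕ} (r : Fin n → B →ₗ[K] K) : (⨂[K]^n B) →ₗ[K] K :=
  PiTensorProduct.lift ((MultilinearMap.mkPiAlgebra K (Fin n) K).compLinearMap r)

@[simp]
lemma tensorFunctional_tprod {n : ℕ} (r : Fin n → B →ₗ[K] K) (x : Fin n → B) :
    tensorFunctional r (PiTensorProduct.tprod K x) = ∏ i, r i (x i) := by
  simp [tensorFunctional]

lemma tensorFunctional_mulEquiv {n : ℕ} (r : Fin (n + 1) → B →ₗ[K] K) (a : ⨂[K]^n B) (y : B) :
    tensorFunctional r (TensorPower.mulEquiv (R := K) (M := B) (n := n) (m := 1)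
      (a ⊗ₜ (PiTensorProduct.subsingletonEquiv (R := K) (s := fun _ : Fin 1 => B) 0).symm y)) =
      tensorFunctional (fun i => r i.castSucc) a * r (Fin.last n) y := by
  induction a using PiTensorProduct.induction_on with
  | add a b ha hb => simp only [TensorProduct.add_tmul, map_add, ha, hb, add_mul]
  | smul_tprod c x =>
    have h : (PiTensorProduct.subsingletonEquiv (R := K) (s := fun _ : Fin 1 => B) 0).symm y =
        PiTensorProduct.tprod K fun _ => y := by
      rw [LinearEquiv.symm_apply_eq]
      simp
    rw [h, ← TensorProduct.smul_tmul', map_smul, map_smul, map_smul, ← TensorPower.gMul_def,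
      TensorPower.tprod_mul_tprod, tensorFunctional_tprod, tensorFunctional_tprod,
      Fin.prod_univ_castSucc, smul_mul_assoc]
    congr 3
    · ext i
      congr 1
      exact Fin.append_left x _ i
    · exact Fin.append_right x (fun _ : Fin 1 => y) 0

/-- Evaluation of a pure tensor of functionals on the iterated reduced coproducts. -/
lemma tensorFunctional_reducedComulIter (n : ℕ) (r : Fin (n + 1) → B →ₗ[K] K) {x : B}
    (hx : counit (R := K) x = 0) : tensorFunctional r (reducedComulIter K B n x) =
      (List.ofFn fun i => toConv (r i ∘ₗ kerProj K B)).prod.ofConv x := by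
  induction n generalizing x with
  | zero =>
    have h : (PiTensorProduct.subsingletonEquiv (R := K) (s := fun _ : Fin 1 => B) 0).symm x =
        PiTensorProduct.tprod K fun _ => x := by
      rw [LinearEquiv.symm_apply_eq]
      simp
    simp [reducedComulIter, h, kerProj_of_counit_eq_zero hx]
  | succ n ih =>
    set l := List.ofFn fun i : Fin (n + 1) => toConv (r i.castSucc ∘ₗ kerProj K B)
    -- The induction hypothesis holds only on ker ε_Δ. It suffices because a nonempty convolution
    -- product of functionals vanishing on 1 vanishes on 1 too, hence factors through `kerProj`.
    have hl : tensorFunctional (fun i => r i.castSucc) ∘ₗ reducedComulIter K B n ∘ₗ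
        kerProj K B = l.prod.ofConv := by
      rw [← comp_kerProj (g := l.prod.ofConv) (conv_prod_one (by simp [l, List.ofFn_succ])
        fun g hg => ?_)]
      · exact LinearMap.ext fun y => ih _ (counit_kerProj y)
      · obtain ⟨i, rfl⟩ := (List.mem_ofFn' _ _).1 hg
        simp [kerProj_one]
    have hmap : ∀ t : B ⊗[K] B, tensorFunctional r (TensorPower.mulEquiv
        (TensorProduct.map (reducedComulIter K B n) (PiTensorProduct.subsingletonEquiv (R := K)
          (s := fun _ : Fin 1 => B) 0).symm.toLinearMap t)) = LinearMap.mul' K K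
        (TensorProduct.map (tensorFunctional (fun i => r i.castSucc) ∘ₗ reducedComulIter K B n)
          (r (Fin.last _)) t) := by
      intro t
      induction t with
      | zero => simp
      | add s t hs ht => simp only [map_add, hs, ht]
      | tmul a b => simpa using tensorFunctional_mulEquiv r (reducedComulIter K B n a) b
    rw [reducedComulIter, LinearMap.comp_apply, LinearMap.comp_apply, ← map_kerProj_comul hx]
    refine (hmap _).trans ?_
    rw [← LinearMap.comp_apply (TensorProduct.map _ _) (TensorProduct.map _ _),
      ← TensorProduct.map_comp, LinearMap.comp_assoc, hl, List.ofFn_succ', List.concat_eq_append,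
      List.prod_append, List.prod_singleton]
    rfl

lemma conv_prod_eq_zero_of_reducedComulIter {n : ℕ} {x : B} (hx : counit (R := K) x = 0)
    (h : reducedComulIter K B n x = 0) {l : List (WithConv (B →ₗ[K] K))}
    (hlen : l.length = n + 1) (hl : ∀ g ∈ l, g.ofConv 1 = 0) : l.prod.ofConv x = 0 := by
  have key := tensorFunctional_reducedComulIter n
    (fun i : Fin (n + 1) => (l.get (i.cast hlen.symm)).ofConv) hx
  rw [h, map_zero] at key
  rw [key]
  refine congrArg (fun l : List (WithConv (B →ₗ[K] K)) => l.prod.ofConv x)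
    (List.ext_get (by rw [List.length_ofFn, hlen]) fun i h1 h2 => ?_)
  simp only [List.get_eq_getElem, List.getElem_ofFn, Fin.val_cast]
  rw [comp_kerProj (hl _ (List.getElem_mem _))]

lemma IsConnectedCoalgebra.isFinitary {Ω : Type w} (hB : IsConnectedCoalgebra K B)
    {f : B →ₗ[K] (Ω →₀ K)} (hf : f 1 = 0) : IsFinitary f := by
  refine IsFinitary.of_length fun x => ?_
  obtain ⟨n, hn⟩ := hB (kerProj K B x) (counit_kerProj x)
  refine ⟨n + 1, fun w hw => ?_⟩
  have hne : ∀ v : List Ω, v ≠ [] → (wordFunctional f v).ofConv 1 = 0 := fun v hv => by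
    obtain ⟨a, v, rfl⟩ := List.exists_cons_of_ne_nil hv
    exact wordFunctional_one hf a v
  have hw' : w ≠ [] := by rintro rfl; simp at hw
  have hd : w.drop n ≠ [] := by simp; omega
  rw [← comp_kerProj (hne w hw')]
  -- A word of length at least n + 1 is regrouped into exactly n + 1 functionals: its first n
  -- letters, then the whole nonempty remainder as one factor.
  have := conv_prod_eq_zero_of_reducedComulIter (counit_kerProj x) hn
    (l := (w.take n).map (fun a => wordFunctional f [a]) ++ [wordFunctional f (w.drop n)])
    (by simp; omega) (by
      intro g hg
      simp only [List.mem_append, List.mem_map, List.mem_singleton] at hg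
      rcases hg with ⟨a, -, rfl⟩ | rfl
      · exact hne _ (by simp)
      · exact hne _ hd)
  rw [LinearMap.comp_apply, ← this]
  congr 2
  conv_lhs => rw [← List.take_append_drop n w, wordFunctional_append]
  simp [wordFunctional]

end Reduced

lemma deg_letterSum {Ω M : Type*} [Add Ω] [AddMonoid M] {deg : Ω → M}
    (hadd : ∀ a b, deg (a + b) = deg a + deg b) (a : Ω) (w : List Ω) :
    deg (letterSum a w) = ((a :: w).map deg).sum := by
  induction w generalizing a with
  | nil => simp [letterSum]
  | cons b w ih => rw [letterSum, hadd, ih]; simp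

/-- ε_δ sees only words of length at most one, and injectivity of the degree leaves a single letter.
The empty word must be excluded separately, since a letter may have degree 0. -/
lemma qsh_epsDelta_of_homogeneous {K : Type u} {Ω : Type v} {M : Type w} [Field K]
    [Add Ω] [AddMonoid M] {deg : Ω → M} (hdeg : Function.Injective deg) {p : QSh K Ω} {a : Ω}
    (hp : ∀ w ∈ p.support, (w.map deg).sum = deg a) (hp0 : p [] = 0) :
    (qshMaps K Ω).epsDelta p = p [a] := by
  simp only [qshMaps, Finsupp.linearCombination_apply]
  rw [Finsupp.sum_eq_single [a]]
  · simp
  · intro w hw hne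
    rcases w with _ | ⟨b, _ | ⟨c, w⟩⟩
    · exact absurd hp0 hw
    · refine absurd ?_ hne
      have := hp [b] (by simpa using hw)
      rw [List.map_singleton, List.sum_singleton] at this
      rw [hdeg this]
    · simp
  · simp

/-! ### The morphism from a graded double bialgebra to `QSh` -/

section GradedMorphism

open Coalgebra WithConv

variable {K : Type u} {B : Type v} {Ω : Type w} {M : Type*} [Field K] [Ring B] [Bialgebra K B]
  [AddMonoid M] [DecidableEq M] {𝒜 : M → Submodule K B} [GradedAlgebra 𝒜] {deg : Ω → M}

lemma IsGradedCoalgebra.counit_proj (hG : IsGradedCoalgebra 𝒜) (m : M) (x : B) :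
    counit (R := K) (GradedAlgebra.proj 𝒜 m x) = if m = 0 then counit (R := K) x else 0 := by
  induction x using DirectSum.Decomposition.inductionOn 𝒜 with
  | zero => simp
  | add x y hx hy => simp only [map_add, hx, hy]; split_ifs <;> simp
  | @homogeneous i x =>
    rw [GradedAlgebra.proj_apply]
    by_cases h : i = m
    · subst h
      rw [DirectSum.decompose_coe, DirectSum.of_eq_same]
      split_ifs with h0
      · rfl
      · exact hG.counit_eq_zero i h0 x x.2
    · rw [DirectSum.decompose_coe, DirectSum.of_eq_of_ne _ _ _ (Ne.symm h)]
      split_ifs with h0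
      · subst h0
        simp [hG.counit_eq_zero i h x x.2]
      · simp

/-- The elements of a graded bialgebra are sums of a scalar and of homogeneous elements of the
kernel of the counit. -/
lemma IsGradedCoalgebra.induction_on (hG : IsGradedCoalgebra 𝒜)
    (hrange : ∀ m ∉ Set.range deg, ∀ x ∈ 𝒜 m, counit (R := K) x = 0 → x = 0)
    {p : B → Prop} (x : B) (scalar : ∀ c : K, p (c • 1))
    (mem : ∀ a, ∀ x ∈ 𝒜 (deg a), counit (R := K) x = 0 → p x)
    (add : ∀ x y, p x → p y → p (x + y)) : p x := by
  classical
  have hp0 : p 0 := by simpa using scalar 0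
  have hx : x = counit (R := K) x • (1 : B) + kerProj K B x := by simp [kerProj_apply]
  rw [hx]
  refine add _ _ (scalar _) ?_
  rw [← DirectSum.sum_support_decompose 𝒜 (kerProj K B x)]
  refine Finset.sum_induction _ p add hp0 fun m _ => ?_
  have hm : counit (R := K) (DirectSum.decompose 𝒜 (kerProj K B x) m : B) = 0 := by
    rw [← GradedAlgebra.proj_apply, hG.counit_proj, counit_kerProj, ite_self]
  by_cases h : m ∈ Set.range deg
  · obtain ⟨a, rfl⟩ := h
    exact mem a _ (SetLike.coe_mem _) hm
  · rw [hrange m h _ (SetLike.coe_mem _) hm]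
    exact hp0

variable (D : DoubleBialgebra K B)

/-- The linear map `x ↦ ∑_m ε_δ(π_m(x)) m`. -/
def epsComponents (𝒜 : M → Submodule K B) [GradedAlgebra 𝒜] : B →ₗ[K] (M →₀ K) :=
  DirectSum.toModule K M (M →₀ K)
    (fun m => Finsupp.lsingle m ∘ₗ D.epsDelta.toLinearMap ∘ₗ (𝒜 m).subtype) ∘ₗ
    (DirectSum.decomposeLinearEquiv 𝒜).toLinearMap

lemma epsComponents_apply (x : B) (m : M) :
    epsComponents D 𝒜 x m = D.epsDelta (GradedAlgebra.proj 𝒜 m x) := by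
  induction x using DirectSum.Decomposition.inductionOn 𝒜 with
  | zero => simp
  | add x y hx hy => simp only [map_add, Finsupp.add_apply, hx, hy]
  | @homogeneous i x =>
    simp only [epsComponents, LinearMap.comp_apply, LinearEquiv.coe_coe,
      DirectSum.decomposeLinearEquiv_apply, DirectSum.decompose_coe, GradedAlgebra.proj_apply]
    rw [← DirectSum.lof_eq_of K, DirectSum.toModule_lof, DirectSum.lof_eq_of]
    by_cases h : i = m
    · subst h
      simp
    · rw [DirectSum.of_eq_of_ne _ _ _ (Ne.symm h)]
      simp [h]

/-- The linear map `B → KΩ` inducing the morphism to the quasishuffle double bialgebra: its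
coordinate of index `α` is `ε_δ ∘ π_α` on the kernel of the counit, and it vanishes on `1`. -/
def letterMap (𝒜 : M → Submodule K B) [GradedAlgebra 𝒜] (hdeg : Function.Injective deg) :
    B →ₗ[K] (Ω →₀ K) :=
  Finsupp.lcomapDomain deg hdeg ∘ₗ epsComponents D 𝒜 ∘ₗ kerProj K B

variable (hdeg : Function.Injective deg)

lemma letterMap_apply (x : B) (a : Ω) : letterMap D 𝒜 hdeg x a =
    D.epsDelta (GradedAlgebra.proj 𝒜 (deg a) (kerProj K B x)) := by
  rw [← epsComponents_apply]
  rfl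

lemma lapply_comp_letterMap (a : Ω) : Finsupp.lapply a ∘ₗ letterMap D 𝒜 hdeg =
    (D.epsDelta.toLinearMap ∘ₗ GradedAlgebra.proj 𝒜 (deg a)) ∘ₗ kerProj K B :=
  LinearMap.ext fun x => letterMap_apply D hdeg x a

lemma letterMap_one : letterMap D 𝒜 hdeg 1 = 0 := by
  ext a
  simp [letterMap_apply, kerProj_one]

lemma proj_of_mem {m : M} {x : B} (hx : x ∈ 𝒜 m) (n : M) :
    GradedAlgebra.proj 𝒜 n x = if m = n then x else 0 := by
  rw [GradedAlgebra.proj_apply]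
  split_ifs with h
  · rw [← h, DirectSum.decompose_of_mem_same _ hx]
  · rw [DirectSum.decompose_of_mem_ne _ hx h]

lemma letterMap_of_mem_ker {a : Ω} {x : B} (hx : x ∈ 𝒜 (deg a)) (h0 : counit (R := K) x = 0) :
    letterMap D 𝒜 hdeg x = Finsupp.single a (D.epsDelta x) := by
  classical
  ext b
  rw [letterMap_apply, kerProj_of_counit_eq_zero h0, proj_of_mem hx, Finsupp.single_apply]
  by_cases h : a = b
  · simp [h]
  · simp [h, hdeg.ne h]

/-- The left factors of δ(x) are homogeneous but need not lie in ker ε_Δ, so the correction made by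
`kerProj` has to be kept, as a multiple of ε_Δ. -/
lemma letterMap_apply_of_mem {m : M} {x : B} (hx : x ∈ 𝒜 m) (a : Ω) :
    letterMap D 𝒜 hdeg x a = (if m = deg a then 1 else 0) * D.epsDelta x -
      D.epsDelta (GradedAlgebra.proj 𝒜 (deg a) 1) * counit (R := K) x := by
  rw [letterMap_apply, kerProj_apply, map_sub, map_smul, proj_of_mem hx]
  split_ifs <;> simp [mul_comm]

lemma letterMap_apply_eq_zero (hG : IsGradedCoalgebra 𝒜) {m : M} {x : B} (hx : x ∈ 𝒜 m) {a : Ω}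
    (h : m ≠ deg a) : letterMap D 𝒜 hdeg x a = 0 := by
  rw [letterMap_apply_of_mem D hdeg hx]
  by_cases h0 : m = 0
  · subst h0
    simp [proj_of_mem SetLike.GradedOne.one_mem, h]
  · simp [h, hG.counit_eq_zero m h0 x hx]

lemma wordFunctional_letterMap_eq_zero (hG : IsGradedCoalgebra 𝒜) (w : List Ω) {m : M} {x : B}
    (hx : x ∈ 𝒜 m) (h : (w.map deg).sum ≠ m) :
    (wordFunctional (letterMap D 𝒜 hdeg) w).ofConv x = 0 := by
  induction w generalizing m x with
  | nil =>
    rw [wordFunctional_nil_apply]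
    exact hG.counit_eq_zero m (Ne.symm h) x hx
  | cons a w ih =>
    rw [wordFunctional_cons_apply]
    -- Vanishing at Δ(x) is membership in the kernel of a linear form, so it can be tested on each
    -- B_b ⊗ B_c: either b is the wrong degree for the first letter or c is wrong for the rest.
    have key : ⨆ (p : M × M) (_ : p.1 + p.2 = m),
        LinearMap.range (TensorProduct.map (𝒜 p.1).subtype (𝒜 p.2).subtype) ≤
        LinearMap.ker (LinearMap.mul' K K ∘ₗ TensorProduct.map
          (Finsupp.lapply a ∘ₗ letterMap D 𝒜 hdeg)
          (wordFunctional (letterMap D 𝒜 hdeg) w).ofConv) := by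
      refine iSup₂_le ?_
      rintro ⟨b, c⟩ rfl
      rw [LinearMap.range_le_ker_iff]
      ext ⟨y, hy⟩ ⟨z, hz⟩
      simp only [TensorProduct.AlgebraTensorModule.curry_apply, TensorProduct.curry_apply,
        LinearMap.restrictScalars_self, LinearMap.comp_apply, TensorProduct.map_tmul,
        Submodule.subtype_apply, LinearMap.mul'_apply, LinearMap.zero_apply, Finsupp.lapply_apply]
      by_cases hb : b = deg a
      · subst hb
        rw [ih hz, mul_zero]
        rintro rfl
        exact h (by simp)
      · rw [letterMap_apply_eq_zero D hdeg hG hy hb, zero_mul]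
    exact key (hG.comul_mem m x hx)

lemma cofreeLift_isHomogeneousHom
    (hfin : IsFinitary (letterMap D 𝒜 hdeg)) (hG : IsGradedCoalgebra 𝒜) :
    IsHomogeneousHom deg 𝒜 (cofreeLift hfin) := by
  intro m x hx w hw
  by_contra h
  exact Finsupp.mem_support_iff.1 hw (wordFunctional_letterMap_eq_zero D hdeg hG w hx h)

section Add

variable [Add Ω]

/-- For homogeneous elements of ker ε_Δ the counit terms vanish and the identity is ε_δ(xy) =
ε_δ(x)ε_δ(y), with additive degrees. The counit terms account for the scalars. -/
lemma letterMap_mul (hG : IsGradedCoalgebra 𝒜) (hadd : ∀ a b, deg (a + b) = deg a + deg b)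
    (hrange : ∀ m ∉ Set.range deg, ∀ x ∈ 𝒜 m, counit (R := K) x = 0 → x = 0) (x y : B) :
    letterMap D 𝒜 hdeg (x * y) =
      counit (R := K) y • letterMap D 𝒜 hdeg x + counit (R := K) x • letterMap D 𝒜 hdeg y +
        letterMul K Ω (letterMap D 𝒜 hdeg x) (letterMap D 𝒜 hdeg y) := by
  induction x using hG.induction_on hrange with
  | scalar c => simp [letterMap_one]
  | add x x' hx hx' =>
    simp only [add_mul, map_add, hx, hx', smul_add, add_smul, LinearMap.add_apply]
    abel
  | mem a x hxa hx =>
  induction y using hG.induction_on hrange with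
  | scalar c => simp [letterMap_one]
  | add y y' hy hy' =>
    simp only [mul_add, map_add, hy, hy', smul_add, add_smul]
    abel
  | mem b y hyb hy =>
    have hxy : x * y ∈ 𝒜 (deg (a + b)) := by
      rw [hadd]
      exact SetLike.mul_mem_graded hxa hyb
    rw [letterMap_of_mem_ker D hdeg hxa hx, letterMap_of_mem_ker D hdeg hyb hy,
      letterMap_of_mem_ker D hdeg hxy (by simp [hx])]
    simp [hx, hy]

open Classical in
lemma sumProj_apply (α : Ω) (p : QSh K Ω) (w : List Ω) :
    sumProj K α p w = match w with
      | [] => 0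
      | a :: v => if letterSum a v = α then p (a :: v) else 0 := by
  induction p using Finsupp.induction_linear with
  | zero => cases w <;> simp
  | add p q hp hq =>
    rw [map_add, Finsupp.add_apply, hp, hq]
    cases w <;> simp
    split_ifs <;> simp
  | single z c =>
    rcases z with _ | ⟨b, z⟩
    · cases w <;> simp [sumProj]
    · by_cases h : b :: z = w
      · subst h
        simp only [sumProj, Finsupp.linearCombination_single]
        split_ifs <;> simp
      · simp only [sumProj, Finsupp.linearCombination_single]
        cases w
        · split_ifs <;> simp
        · simp only [Finsupp.single_apply, if_neg h, ite_self]
          split_ifs <;> simp [h]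

/-- Each word in the support has a letter sum of degree m, so by injectivity either all of them
survive the projection or none does. -/
lemma sumProj_of_homogeneous (hdeg : Function.Injective deg)
    (hadd : ∀ a b, deg (a + b) = deg a + deg b) {p : QSh K Ω} {m : M}
    (hp : ∀ w ∈ p.support, (w.map deg).sum = m) (hp0 : p [] = 0) (a : Ω) :
    sumProj K a p = (if m = deg a then (1 : K) else 0) • p := by
  classical
  ext w
  rw [sumProj_apply, Finsupp.smul_apply, smul_eq_mul]
  rcases w with _ | ⟨b, v⟩
  · simp [hp0]
  · by_cases h0 : p (b :: v) = 0
    · simp [h0]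
    · have := hp (b :: v) (by simpa using h0)
      rw [← deg_letterSum hadd] at this
      subst this
      simp [hdeg.eq_iff]

variable (hfin : IsFinitary (letterMap D 𝒜 hdeg))

/-- The one-letter case of compatibility with δ. On B_b the functional f_a is a multiple of ε_δ,
nonzero only for b = a, minus a multiple of ε_Δ. Contracting δ(x) with ε_δ returns x by the counit
axiom; contracting with ε_Δ gives ε_Δ(x)1 = 0. -/
lemma sumProj_cofreeLift (hG : IsGradedCoalgebra 𝒜) (hD : D.DeltaCompatible 𝒜)
    (hadd : ∀ a b, deg (a + b) = deg a + deg b)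
    (hrange : ∀ m ∉ Set.range deg, ∀ x ∈ 𝒜 m, counit (R := K) x = 0 → x = 0)
    (a : Ω) (x : B) : sumProj K a (cofreeLift hfin x) = TensorProduct.lid K _
      (TensorProduct.map (Finsupp.lapply a ∘ₗ letterMap D 𝒜 hdeg) (cofreeLift hfin)
        (D.delta x)) := by
  induction x using hG.induction_on hrange with
  | scalar c =>
    simp [cofreeLift_one hfin (letterMap_one D hdeg), sumProj, Algebra.TensorProduct.one_def,
      letterMap_one]
  | add x y hx hy => simp only [map_add, hx, hy]
  | mem b x hxb hx =>
    rw [sumProj_of_homogeneous hdeg hadd (cofreeLift_isHomogeneousHom D hdeg hfin hG _ x hxb)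
      (by rw [cofreeLift_apply_nil, hx])]
    have h1 : TensorProduct.lid K _ ((cofreeLift hfin).lTensor K
        (D.epsDelta.toLinearMap.rTensor B (D.delta x))) = cofreeLift hfin x := by
      simp [D.counit_left]
    have h2 : TensorProduct.lid K _ ((cofreeLift hfin).lTensor K
        ((counit (R := K) (A := B)).rTensor B (D.delta x))) = 0 := by
      simp [D.counit_coaction, hx]
    obtain ⟨s, hs⟩ := hD _ x hxb
    rw [← hs] at h1 h2
    rw [← hs]
    have key : ∀ s : 𝒜 (deg b) ⊗[K] B, TensorProduct.lid K _
        (TensorProduct.map (Finsupp.lapply a ∘ₗ letterMap D 𝒜 hdeg) (cofreeLift hfin)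
          ((𝒜 (deg b)).subtype.rTensor B s)) =
        (if deg b = deg a then (1 : K) else 0) • TensorProduct.lid K _
          ((cofreeLift hfin).lTensor K (D.epsDelta.toLinearMap.rTensor B
            ((𝒜 (deg b)).subtype.rTensor B s))) -
        D.epsDelta (GradedAlgebra.proj 𝒜 (deg a) 1) • TensorProduct.lid K _
          ((cofreeLift hfin).lTensor K ((counit (R := K) (A := B)).rTensor B
            ((𝒜 (deg b)).subtype.rTensor B s))) := by
      intro s
      induction s with
      | zero => simp
      | add s t hs ht =>
        simp only [map_add, hs, ht, smul_add]
        abel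
      | tmul y z =>
        simp [letterMap_apply_of_mem D hdeg y.2, sub_smul, mul_smul]
    rw [key, h1, h2, smul_zero, sub_zero]

/-- Induction on the word: `deltaCoeff_cons` splits the first block off inside `QSh`, and the
cointeraction axiom performs the same splitting in B. -/
lemma deltaCoeff_cofreeLift (hG : IsGradedCoalgebra 𝒜) (hD : D.DeltaCompatible 𝒜)
    (hadd : ∀ a b, deg (a + b) = deg a + deg b)
    (hrange : ∀ m ∉ Set.range deg, ∀ x ∈ 𝒜 m, counit (R := K) x = 0 → x = 0)
    (w : List Ω) (x : B) : deltaCoeff K w (cofreeLift hfin x) = TensorProduct.lid K _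
      (TensorProduct.map (wordFunctional (letterMap D 𝒜 hdeg) w).ofConv (cofreeLift hfin)
        (D.delta x)) := by
  induction w generalizing x with
  | nil =>
    have h : (wordFunctional (letterMap D 𝒜 hdeg) []).ofConv = counit :=
      LinearMap.ext fun x => wordFunctional_nil_apply _ x
    rw [deltaCoeff_nil, cofreeLift_apply_nil, h, ← LinearMap.lTensor_comp_rTensor,
      LinearMap.comp_apply, D.counit_coaction]
    simp [cofreeLift_one hfin (letterMap_one D hdeg)]
  | cons a w ih =>
    set f := letterMap D 𝒜 hdeg
    set φ := cofreeLift hfin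
    have e1 : sumProj K a ∘ₗ φ = (TensorProduct.lid K _).toLinearMap ∘ₗ
        TensorProduct.map (Finsupp.lapply a ∘ₗ f) φ ∘ₗ D.delta.toLinearMap :=
      LinearMap.ext fun x => sumProj_cofreeLift D hdeg hfin hG hD hadd hrange a x
    have e2 : deltaCoeff K w ∘ₗ φ = (TensorProduct.lid K _).toLinearMap ∘ₗ
        TensorProduct.map (wordFunctional f w).ofConv φ ∘ₗ D.delta.toLinearMap :=
      LinearMap.ext fun x => ih x
    have e3 : (wordFunctional f (a :: w)).ofConv = (LinearMap.mul' K K ∘ₗ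
        TensorProduct.map (Finsupp.lapply a ∘ₗ f) (wordFunctional f w).ofConv) ∘ₗ comul :=
      LinearMap.ext fun x => wordFunctional_cons_apply f a w x
    -- Contracting two copies of δ and then multiplying agrees with applying m_{1,3,24} before
    -- contracting; this is where multiplicativity of the lift enters.
    have e4 : TensorProduct.lift (qshMul K Ω) ∘ₗ TensorProduct.map
          ((TensorProduct.lid K _).toLinearMap ∘ₗ
            TensorProduct.map (Finsupp.lapply a ∘ₗ f) φ)
          ((TensorProduct.lid K _).toLinearMap ∘ₗ
            TensorProduct.map (wordFunctional f w).ofConv φ) =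
        (TensorProduct.lid K _).toLinearMap ∘ₗ TensorProduct.map (LinearMap.mul' K K ∘ₗ
          TensorProduct.map (Finsupp.lapply a ∘ₗ f) (wordFunctional f w).ofConv) φ ∘ₗ
          (LinearMap.mul' K B).lTensor (B ⊗[K] B) ∘ₗ
            (TensorProduct.tensorTensorTensorComm K B B B B).toLinearMap := by
      refine TensorProduct.ext_fourfold' fun y z y' z' => ?_
      have := cofreeLift_mul hfin (letterMap_mul D hdeg hG hadd hrange) z z'
      simp only [LinearMap.comp_apply, TensorProduct.map_tmul, LinearEquiv.coe_coe,
        TensorProduct.lid_tmul, TensorProduct.lift.tmul, map_smul, LinearMap.smul_apply,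
        TensorProduct.tensorTensorTensorComm_tmul, LinearMap.lTensor_tmul, LinearMap.mul'_apply]
      rw [this, smul_smul, mul_comm]
    rw [deltaCoeff_cons, cofreeLift_comul, ← LinearMap.comp_apply (TensorProduct.map _ _)
      (TensorProduct.map _ _), ← TensorProduct.map_comp, e1, e2, ← LinearMap.comp_assoc,
      ← LinearMap.comp_assoc, TensorProduct.map_comp, LinearMap.comp_apply,
      ← LinearMap.comp_apply (TensorProduct.lift _), e4, e3,
      ← LinearMap.map_comp_rTensor (f' := comul)]
    have hco := LinearMap.congr_fun D.cointeraction x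
    simp only [LinearMap.comp_apply] at hco ⊢
    rw [← hco]
    rfl

/-- Existence, uniqueness and description of the homogeneous morphism from a graded double
bialgebra to a quasishuffle double bialgebra. -/
theorem exists_unique_hom_qsh (hG : IsGradedCoalgebra 𝒜) (hD : D.DeltaCompatible 𝒜)
    (hadd : ∀ a b, deg (a + b) = deg a + deg b)
    (hrange : ∀ m ∉ Set.range deg, ∀ x ∈ 𝒜 m, counit (R := K) x = 0 → x = 0)
    (hfin : IsFinitary (letterMap D 𝒜 hdeg)) :
    ∃ φ : B →ₗ[K] QSh K Ω,
      (IsDoubleBialgebraHom D.maps (qshMaps K Ω) φ ∧ IsHomogeneousHom deg 𝒜 φ) ∧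
      (∀ ψ : B →ₗ[K] QSh K Ω, IsDoubleBialgebraHom D.maps (qshMaps K Ω) ψ →
        IsHomogeneousHom deg 𝒜 ψ → ψ = φ) ∧
      ∀ x : B, counit (R := K) x = 0 →
        φ x [] = 0 ∧
        ∀ (n : ℕ) (α : Fin (n + 1) → Ω),
          φ x (List.ofFn α) = D.gradedCoeff 𝒜 n (fun i => deg (α i)) x := by
  have hone := cofreeLift_one hfin (letterMap_one D hdeg)
  have hhom := cofreeLift_isHomogeneousHom D hdeg hfin hG
  refine ⟨cofreeLift hfin, ⟨⟨hone, ?_, ?_, ?_, ?_, ?_⟩, hhom⟩, ?_, fun x hx => ⟨?_, ?_⟩⟩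
  · exact cofreeLift_mul hfin (letterMap_mul D hdeg hG hadd hrange)
  · exact LinearMap.ext fun x => cofreeLift_comul hfin x
  · exact LinearMap.ext fun x => cofreeLift_apply_nil hfin x
  · refine LinearMap.ext fun x => eq_of_forall_lid_rTensor_lapply fun w => ?_
    rw [LinearMap.comp_apply, lid_rTensor_lapply_delta,
      deltaCoeff_cofreeLift D hdeg hfin hG hD hadd hrange, LinearMap.comp_apply,
      ← lapply_comp_cofreeLift hfin, ← LinearMap.rTensor_comp_map]
    rfl
  · refine LinearMap.ext fun x => ?_
    induction x using hG.induction_on hrange with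
    | scalar c =>
      simp [hone, qshMaps, DoubleBialgebra.maps]
    | add x y hx hy => rw [map_add, map_add, hx, hy]
    | mem a x hxa hx =>
      rw [LinearMap.comp_apply, qsh_epsDelta_of_homogeneous hdeg (hhom _ x hxa)
        (by rw [cofreeLift_apply_nil, hx]), cofreeLift_apply_singleton,
        letterMap_of_mem_ker D hdeg hxa hx]
      simp [DoubleBialgebra.maps]
  · intro ψ hψ hψhom
    ext x w
    -- Only one-letter coefficients remain to be compared. On a homogeneous element of ker ε_Δ,
    -- homogeneity excludes every letter but one, whose coefficient is given by ε_δ.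
    refine apply_eq_wordFunctional hψ.map_comul hψ.map_counit (fun x b => ?_) x w
    have hψ1 : ψ 1 = Finsupp.single [] 1 := hψ.map_one
    induction x using hG.induction_on hrange with
    | scalar c => simp [hψ1, letterMap_one]
    | add x y hx hy => rw [map_add, map_add, Finsupp.add_apply, Finsupp.add_apply, hx, hy]
    | mem a x hxa hx =>
      classical
      rw [letterMap_of_mem_ker D hdeg hxa hx]
      by_cases h : a = b
      · subst h
        have h0 : ψ x [] = 0 := by
          rw [← hx]
          exact congr($(hψ.map_counit) x)
        rw [← qsh_epsDelta_of_homogeneous hdeg (hψhom _ x hxa) h0, Finsupp.single_eq_same]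
        exact congr($(hψ.map_epsDelta) x)
      · rw [Finsupp.single_apply, if_neg h]
        by_contra hne
        have := hψhom _ x hxa [b] (by simpa using hne)
        rw [List.map_singleton, List.sum_singleton] at this
        exact h (hdeg this).symm
  · rw [cofreeLift_apply_nil, hx]
  · intro n α
    have : D.gradedCoeff 𝒜 n (fun i => deg (α i)) x = tensorFunctional
        (fun i => D.epsDelta.toLinearMap ∘ₗ GradedAlgebra.proj 𝒜 (deg (α i)))
        (reducedComulIter K B n x) := by
      rw [DoubleBialgebra.gradedCoeff, tensorPowFunctional, ← LinearMap.comp_apply]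
      congr 1
      ext y
      simp
    rw [this, tensorFunctional_reducedComulIter _ _ hx, cofreeLift_apply, wordFunctional,
      List.map_ofFn]
    simp only [Function.comp_def, lapply_comp_letterMap]

end Add

end GradedMorphism

/-! ### Separating functionals and transport of morphisms -/

/-- Elements of a tensor product are separated by tensor products of functionals taken in
separating families. -/
lemma eq_of_forall_mul'_map {K : Type u} {V W ι κ : Type*} [Field K] [AddCommGroup V] [Module K V]
    [AddCommGroup W] [Module K W] {f : ι → V →ₗ[K] K} {g : κ → W →ₗ[K] K}
    (hf : ∀ x, (∀ i, f i x = 0) → x = 0) (hg : ∀ y, (∀ j, g j y = 0) → y = 0) {s t : V ⊗[K] W}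
    (h : ∀ i j, LinearMap.mul' K K (TensorProduct.map (f i) (g j) s) =
      LinearMap.mul' K K (TensorProduct.map (f i) (g j) t)) : s = t := by
  classical
  rw [← sub_eq_zero]
  replace h : ∀ i j, LinearMap.mul' K K (TensorProduct.map (f i) (g j) (s - t)) = 0 := fun i j => by
    rw [map_sub, map_sub, h, sub_self]
  generalize s - t = r at h
  have h1 : ∀ i, TensorProduct.lid K W ((f i).rTensor W r) = 0 := by
    refine fun i => hg _ fun j => ?_
    rw [← h i j]
    clear h
    induction r with
    | zero => simp
    | add x y hx hy => simp only [map_add, hx, hy]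
    | tmul x y => simp
  -- The coordinates of `r` in a basis of W are vectors of V, and `h1` says that every `f i` kills
  -- them.
  let b := Module.Basis.ofVectorSpace K W
  apply (TensorProduct.equivFinsuppOfBasisRight (M := V) b).injective
  ext k
  rw [map_zero, Finsupp.zero_apply]
  refine hf _ fun i => ?_
  have h2 := congr(b.repr $(h1 i) k)
  rw [map_zero, Finsupp.zero_apply] at h2
  rw [← h2]
  clear h h1 h2
  induction r with
  | zero => simp
  | add x y hx hy => simp only [map_add, Finsupp.add_apply, hx, hy]
  | tmul x y => simp [mul_comm]

section StructureMaps

variable {K : Type u} {A A' A'' : Type*} [Field K] [AddCommGroup A] [Module K A]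
  [AddCommGroup A'] [Module K A'] [AddCommGroup A''] [Module K A'']
  {S : StructureMaps K A} {T : StructureMaps K A'} {U : StructureMaps K A''}

lemma IsDoubleBialgebraHom.comp {ψ : A' →ₗ[K] A''} {φ : A →ₗ[K] A'}
    (hψ : IsDoubleBialgebraHom T U ψ) (hφ : IsDoubleBialgebraHom S T φ) :
    IsDoubleBialgebraHom S U (ψ ∘ₗ φ) where
  map_one := by simp [hφ.map_one, hψ.map_one]
  map_mul x y := by simp [hφ.map_mul, hψ.map_mul]
  map_comul := by
    rw [← LinearMap.comp_assoc, hψ.map_comul, LinearMap.comp_assoc, hφ.map_comul,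
      ← LinearMap.comp_assoc, TensorProduct.map_comp]
  map_counit := by rw [← LinearMap.comp_assoc, hψ.map_counit, hφ.map_counit]
  map_delta := by
    rw [← LinearMap.comp_assoc, hψ.map_delta, LinearMap.comp_assoc, hφ.map_delta,
      ← LinearMap.comp_assoc, TensorProduct.map_comp]
  map_epsDelta := by rw [← LinearMap.comp_assoc, hψ.map_epsDelta, hφ.map_epsDelta]

lemma comp_symm_eq_map_symm_comp {e : A ≃ₗ[K] A'} {d : A →ₗ[K] A ⊗[K] A}
    {d' : A' →ₗ[K] A' ⊗[K] A'}
    (h : d' ∘ₗ e.toLinearMap = TensorProduct.map e.toLinearMap e.toLinearMap ∘ₗ d) :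
    d ∘ₗ e.symm.toLinearMap =
      TensorProduct.map e.symm.toLinearMap e.symm.toLinearMap ∘ₗ d' := by
  refine LinearMap.ext fun x => ?_
  have hx := congr(TensorProduct.map e.symm.toLinearMap e.symm.toLinearMap
    ($h (e.symm x)))
  rw [LinearMap.comp_apply, LinearMap.comp_apply, ← LinearMap.comp_apply (TensorProduct.map _ _)
    (TensorProduct.map _ _), ← TensorProduct.map_comp] at hx
  simpa using hx.symm

lemma IsDoubleBialgebraHom.symm {e : A ≃ₗ[K] A'} (he : IsDoubleBialgebraHom S T e.toLinearMap) :
    IsDoubleBialgebraHom T S e.symm.toLinearMap where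
  map_one := by
    rw [← he.map_one]
    simp
  map_mul x y := e.injective <| by
    have := he.map_mul (e.symm x) (e.symm y)
    simp only [LinearEquiv.coe_coe, LinearEquiv.apply_symm_apply] at this ⊢
    exact this.symm
  map_comul := comp_symm_eq_map_symm_comp he.map_comul
  map_counit := by
    rw [← he.map_counit]
    ext
    simp
  map_delta := comp_symm_eq_map_symm_comp he.map_delta
  map_epsDelta := by
    rw [← he.map_epsDelta]
    ext
    simp

end StructureMaps

/-- Vandermonde's identity with the term of index 0 set apart. -/
lemma sum_choose_succ_mul_choose (m n k : ℕ) :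
    ∑ i ∈ Finset.range (k + 1), m.choose (i + 1) * n.choose (k - i) + n.choose (k + 1) =
      (m + n).choose (k + 1) := by
  rw [Nat.add_choose_eq, Finset.Nat.sum_antidiagonal_eq_sum_range_succ
    (fun i j => m.choose i * n.choose j), Finset.sum_range_succ' _ (k + 1)]
  simp

/-! ### K[X] as the quasishuffle double bialgebra on one letter -/

section Hilbert

open Polynomial

variable (K : Type u) [Field K]

/-- The evaluation of a polynomial at a natural number. -/
def evalNat (N : ℕ) : K[X] →ₗ[K] K := (aeval (N : K)).toLinearMap

-- Evaluation turns Δ into addition of points, and below it turns δ into their multiplication: both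
-- sides are algebra maps, compared on X.
variable {K} in
lemma mul'_map_evalNat_comul (N M : ℕ) (P : K[X]) :
    LinearMap.mul' K K (TensorProduct.map (evalNat K N) (evalNat K M) ((polyMaps K).comul P)) =
      evalNat K (N + M) P := by
  have : (Algebra.TensorProduct.lmul' K (S := K)).comp
      ((Algebra.TensorProduct.map (aeval (N : K)) (aeval (M : K))).comp
        (aeval ((X : K[X]) ⊗ₜ[K] (1 : K[X]) + (1 : K[X]) ⊗ₜ[K] (X : K[X])))) =
      aeval ((N + M : ℕ) : K) := by
    ext
    simp
  exact congr($this P)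

variable {K} in
lemma mul'_map_evalNat_delta (N M : ℕ) (P : K[X]) :
    LinearMap.mul' K K (TensorProduct.map (evalNat K N) (evalNat K M) ((polyMaps K).delta P)) =
      evalNat K (N * M) P := by
  have : (Algebra.TensorProduct.lmul' K (S := K)).comp
      ((Algebra.TensorProduct.map (aeval (N : K)) (aeval (M : K))).comp
        (aeval ((X : K[X]) ⊗ₜ[K] (X : K[X])))) = aeval ((N * M : ℕ) : K) := by
    ext
    simp
  exact congr($this P)

variable {K} in
lemma finite_replicate_ne_zero (p : QSh K Unit) :
    {n : ℕ | p (List.replicate (n + 1) ()) ≠ 0}.Finite := by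
  refine p.hasFiniteSupport.preimage (f := fun n => List.replicate (n + 1) ()) ?_
  intro n _ m _ h
  simpa using congrArg List.length h

variable [CharZero K]

lemma eval_hilbertPoly (N n : ℕ) : (hilbertPoly K n).eval (N : K) = (N.choose n : K) := by
  have h : (∏ i ∈ Finset.range n, (X - C (i : K))).eval (N : K) =
      ((n.factorial * N.choose n : ℕ) : K) := by
    rw [← Nat.descFactorial_eq_factorial_mul_choose, ← descPochhammer_eval_eq_descFactorial,
      descPochhammer_eval_eq_prod_range, eval_prod]
    simp
  rw [hilbertPoly, eval_mul, h, eval_C, Nat.cast_mul, inv_mul_cancel_left₀]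
  exact_mod_cast n.factorial_ne_zero

lemma degree_hilbertPoly (n : ℕ) : (hilbertPoly K n).degree = n := by
  have : ((n.factorial : K)⁻¹) ≠ 0 := inv_ne_zero (by exact_mod_cast n.factorial_ne_zero)
  rw [hilbertPoly, degree_C_mul this, degree_prod]
  simp [-map_natCast]

/-- The Hilbert polynomials, as a sequence with one polynomial of each degree. -/
def hilbertSequence : Polynomial.Sequence K where
  elems' := hilbertPoly K
  degree_eq' := degree_hilbertPoly K

/-- The words on a one-letter alphabet are classified by their length. -/
def natEquivListUnit : ℕ ≃ List Unit where
  toFun n := List.replicate n ()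
  invFun w := w.length
  left_inv n := by simp
  right_inv w := (List.eq_replicate_of_mem fun _ _ => rfl).symm

/-- The linear isomorphism from `QSh` on a one-letter alphabet to `K[X]` sending the word of
length `n` to the Hilbert polynomial `H_n`. -/
def qshUnitEquiv : QSh K Unit ≃ₗ[K] K[X] :=
  (((hilbertSequence K).basis fun i => by simp).reindex natEquivListUnit).repr.symm

@[simp]
lemma qshUnitEquiv_single (w : List Unit) (c : K) :
    qshUnitEquiv K (Finsupp.single w c) = c • hilbertPoly K w.length := by
  simp [qshUnitEquiv, Sequence.basis_eq_self]
  rfl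

variable {K} in
lemma eq_zero_of_forall_evalNat (p : K[X]) (h : ∀ N, evalNat K N p = 0) : p = 0 := by
  refine eq_of_infinite_eval_eq p 0
    ((Set.infinite_range_of_injective (Nat.cast_injective (R := K))).mono ?_)
  rintro _ ⟨N, rfl⟩
  simpa [evalNat, coe_aeval_eq_eval] using h N

/-- The evaluation at a natural number, transported to `QSh` on a one-letter alphabet. -/
def qshEval (N : ℕ) : QSh K Unit →ₗ[K] K := evalNat K N ∘ₗ (qshUnitEquiv K).toLinearMap

variable {K}

lemma qshEval_single (N : ℕ) (w : List Unit) (c : K) :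
    qshEval K N (Finsupp.single w c) = c * N.choose w.length := by
  simp [qshEval, evalNat, coe_aeval_eq_eval, eval_hilbertPoly]

lemma qshEval_eq_linearCombination (N : ℕ) : qshEval K N =
    Finsupp.linearCombination K fun w : List Unit => (N.choose w.length : K) := by
  ext w
  simp [qshEval_single]

lemma qshEval_zero (p : QSh K Unit) : qshEval K 0 p = p [] := by
  induction p using Finsupp.induction_linear with
  | zero => simp
  | add p q hp hq => simp [hp, hq]
  | single w c => cases w <;> simp [qshEval_single]

/-- Pascal's rule, in a form suited to the head-tail recursion. -/
lemma qshEval_succ (N : ℕ) (p : QSh K Unit) : qshEval K (N + 1) p = qshEval K N p +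
    LinearMap.mul' K K (TensorProduct.map (Finsupp.lapply ()) (qshEval K N)
      (headTail K Unit p)) := by
  induction p using Finsupp.induction_linear with
  | zero => simp
  | add p q hp hq => simp only [map_add, hp, hq]; ring
  | single w c =>
    cases w
    · simp [qshEval_single]
    · simp [qshEval_single, Nat.choose_succ_succ]
      ring

/-- By `qshEval_succ`, evaluation at N + 1 is evaluation at N plus a head-tail term L. The
quasishuffle recursion then expands exactly as the product of two such sums. -/
lemma qshEval_mul (N : ℕ) (p q : QSh K Unit) :
    qshEval K N (qshMul K Unit p q) = qshEval K N p * qshEval K N q := by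
  induction N generalizing p q with
  | zero => simp only [qshEval_zero, qshMul_apply_nil]
  | succ N ih =>
    set L := LinearMap.mul' K K ∘ₗ TensorProduct.map (Finsupp.lapply ()) (qshEval K N) with hL
    have hsucc : ∀ p, qshEval K (N + 1) p = qshEval K N p + L (headTail K Unit p) :=
      qshEval_succ N
    have h1 : ∀ t, L (((qshMul K Unit).flip q).lTensor _ t) = L t * qshEval K N q := by
      intro t
      induction t with
      | zero => simp
      | add s t hs ht => simp only [map_add, hs, ht, add_mul]
      | tmul a b => simp [hL, ih, mul_assoc]
    have h2 : ∀ t, L ((qshMul K Unit p).lTensor _ t) = qshEval K N p * L t := by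
      intro t
      induction t with
      | zero => simp
      | add s t hs ht => simp only [map_add, hs, ht, mul_add]
      | tmul a b => simp [hL, ih, mul_left_comm]
    have h0 : ∀ a b, letterMul K Unit a b () = a () * b () := by
      intro a b
      induction a using Finsupp.induction_linear with
      | zero => simp
      | add a a' ha ha' => simp [ha, ha', add_mul]
      | single i c =>
      induction b using Finsupp.induction_linear with
      | zero => simp
      | add b b' hb hb' => simp only [map_add, Finsupp.add_apply, hb, hb', mul_add]
      | single j d => simp
    have h3 : ∀ s t, L (headTailMul K Unit s t) = L s * L t := by
      intro s t
      induction s with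
      | zero => simp
      | add s s' hs hs' => simp only [map_add, LinearMap.add_apply, hs, hs', add_mul]
      | tmul a b =>
      induction t with
      | zero => simp
      | add t t' ht ht' => simp only [map_add, ht, ht', mul_add]
      | tmul a' b' =>
        simp [hL, ih, h0]
        ring
    rw [hsucc, hsucc, hsucc, headTail_qshMul, map_add, map_add, h1, h2, h3, ih]
    ring

/-- Induction on N, with Pascal's rule applied to the number of blocks. One part is the induction
hypothesis for the whole word. In the other the first block is evaluated at M and the remainder at
NM, and Vandermonde's identity recombines everything into (N + 1)M. -/
lemma qshEval_deltaContract (N M : ℕ) (p : QSh K Unit) :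
    qshEval K M (deltaContract (fun w => (N.choose w.length : K)) p) = qshEval K (N * M) p := by
  induction N generalizing p with
  | zero =>
    have : (fun w : List Unit => ((Nat.choose 0 w.length : ℕ) : K)) =
        fun w => by classical exact if w = [] then 1 else 0 := by
      ext w
      cases w <;> simp
    rw [zero_mul, qshEval_zero, this]
    refine (congrArg _ (deltaCoeff_nil p)).trans ?_
    simp [qshEval_single]
  | succ N ih =>
    induction p using Finsupp.induction_linear with
    | zero => simp
    | add p q hp hq => simp only [map_add, hp, hq]
    | single w c =>
      rw [← mul_one c, ← smul_eq_mul, ← Finsupp.smul_single]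
      simp only [map_smul]
      congr 1
      rcases w with _ | ⟨a, v⟩
      · simp [deltaContract_single_nil, qshEval_single]
      · have hsucc : ∀ (q : QSh K Unit),
            deltaContract (fun w => ((N + 1).choose (w.length + 1) : K)) q =
            deltaContract (fun w => (N.choose w.length : K)) q +
            deltaContract (fun w => (N.choose (w.length + 1) : K)) q := by
          intro q
          rw [← lid_rTensor_delta, ← lid_rTensor_delta, ← lid_rTensor_delta, ← map_add,
            ← LinearMap.add_apply, ← LinearMap.rTensor_add]
          congr 3
          ext w
          simp [Nat.choose_succ_succ]
        have hN := ih (Finsupp.single (a :: v) 1)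
        rw [deltaContract_single_cons, map_sum] at hN ⊢
        simp only [List.length_cons, hsucc, map_add, qshEval_mul,
          Finset.sum_add_distrib] at hN ⊢
        rw [hN]
        simp only [ih, qshEval_single, one_mul, List.length_cons, List.length_take,
          List.length_drop]
        rw [Nat.succ_mul, add_comm (N * M) M, ← sum_choose_succ_mul_choose, Nat.cast_add,
          Nat.cast_sum]
        congr 1
        refine Finset.sum_congr rfl fun i hi => ?_
        rw [min_eq_left (by simpa [Nat.lt_succ_iff] using hi), Nat.cast_mul]

/-- `K[X]` is the quasishuffle double bialgebra on a one-letter alphabet. -/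
theorem isDoubleBialgebraHom_qshUnitEquiv :
    IsDoubleBialgebraHom (qshMaps K Unit) (polyMaps K) (qshUnitEquiv K).toLinearMap where
  map_one := by simp [qshMaps, polyMaps, hilbertPoly]
  map_mul p q := by
    rw [← sub_eq_zero]
    refine eq_zero_of_forall_evalNat _ fun N => ?_
    have h : evalNat K N ((polyMaps K).mul (qshUnitEquiv K p) (qshUnitEquiv K q)) =
        qshEval K N p * qshEval K N q := map_mul (aeval (N : K)) _ _
    rw [map_sub, LinearEquiv.coe_coe, h, ← qshEval_mul, sub_eq_zero]
    rfl
  map_comul := by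
    refine LinearMap.ext fun p => ?_
    refine eq_of_forall_mul'_map (f := evalNat K) (g := evalNat K) eq_zero_of_forall_evalNat
      eq_zero_of_forall_evalNat fun N M => ?_
    rw [LinearMap.comp_apply, mul'_map_evalNat_comul, LinearMap.comp_apply,
      ← LinearMap.comp_apply (TensorProduct.map _ _) (TensorProduct.map _ _),
      ← TensorProduct.map_comp]
    change qshEval K (N + M) p = LinearMap.mul' K K
      (TensorProduct.map (qshEval K N) (qshEval K M) _)
    induction p using Finsupp.induction_linear with
    | zero => simp
    | add p q hp hq => simp only [map_add, hp, hq]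
    | single w c =>
      simp only [qshMaps, Finsupp.linearCombination_single, map_smul, map_sum,
        TensorProduct.map_tmul, LinearMap.mul'_apply, qshEval_single, smul_eq_mul, one_mul,
        List.length_take, List.length_drop]
      rw [Nat.add_choose_eq, Finset.Nat.sum_antidiagonal_eq_sum_range_succ
        (fun i j => N.choose i * M.choose j)]
      push_cast
      congr 1
      refine Finset.sum_congr rfl fun i hi => ?_
      rw [min_eq_left (by simpa [Nat.lt_succ_iff] using hi)]
  map_counit := by
    refine LinearMap.ext fun p => ?_
    have := qshEval_zero p
    rw [qshEval, evalNat, Nat.cast_zero] at this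
    exact this
  map_delta := by
    refine LinearMap.ext fun p => ?_
    refine eq_of_forall_mul'_map (f := evalNat K) (g := evalNat K) eq_zero_of_forall_evalNat
      eq_zero_of_forall_evalNat fun N M => ?_
    rw [LinearMap.comp_apply, mul'_map_evalNat_delta, LinearMap.comp_apply,
      ← LinearMap.comp_apply (TensorProduct.map _ _) (TensorProduct.map _ _),
      ← TensorProduct.map_comp]
    change qshEval K (N * M) p = LinearMap.mul' K K
      (TensorProduct.map (qshEval K N) (qshEval K M) _)
    rw [← qshEval_deltaContract, ← lid_rTensor_delta, ← qshEval_eq_linearCombination]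
    generalize (qshMaps K Unit).delta p = t
    induction t with
    | zero => simp
    | add s t hs ht => simp only [map_add, hs, ht]
    | tmul a b => simp
  map_epsDelta := by
    ext w
    -- ε_δ on K[X] is evaluation at 1, and the binomial coefficient of 1 over n is 1 for n ≤ 1 and 0
    -- beyond.
    have h : (aeval (1 : K)).toLinearMap (hilbertPoly K w.length) =
        ((Nat.choose 1 w.length : ℕ) : K) := by
      simpa [coe_aeval_eq_eval] using eval_hilbertPoly K 1 w.length
    simp only [polyMaps, qshMaps, LinearMap.comp_apply, Finsupp.lsingle_apply, LinearEquiv.coe_coe,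
      qshUnitEquiv_single, one_smul, h, Finsupp.linearCombination_single]
    rcases w with _ | ⟨a, _ | ⟨b, w⟩⟩
    · simp
    · simp
    · simp [Nat.choose_eq_zero_of_lt]

lemma qshUnitEquiv_apply (p : QSh K Unit) : qshUnitEquiv K p = C (p []) +
    ∑ᶠ n : ℕ, p (List.replicate (n + 1) ()) • hilbertPoly K (n + 1) := by
  have hfin : ∀ p : QSh K Unit, (Function.support fun n : ℕ =>
      p (List.replicate (n + 1) ()) • hilbertPoly K (n + 1)).Finite := fun p =>
    (finite_replicate_ne_zero p).subset fun n hn h => hn (by simp [h])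
  induction p using Finsupp.induction_linear with
  | zero => simp
  | add p q hp hq =>
    simp only [map_add, hp, hq, Finsupp.add_apply, add_smul]
    rw [finsum_add_distrib (hfin p) (hfin q)]
    abel
  | single w c =>
    obtain ⟨n, rfl⟩ := natEquivListUnit.surjective w
    rcases n with _ | n
    · simp [natEquivListUnit, hilbertPoly, smul_eq_C_mul]
    · rw [finsum_eq_single _ n]
      · simp [natEquivListUnit]
      · intro m hm
        rw [Finsupp.single_apply, if_neg, zero_smul]
        intro h
        apply hm
        simpa [natEquivListUnit] using (congrArg List.length h).symm

end Hilbert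

/-! ### Specialisation to K[X], `QSym` and `QSh` -/

/-- The trivial grading of an algebra by a one-element monoid. -/
abbrev trivialGradedAlgebra (K : Type u) (B : Type v) [CommSemiring K] [Semiring B] [Algebra K B] :
    GradedAlgebra (fun _ : Unit => (⊤ : Submodule K B)) where
  one_mem := Submodule.mem_top
  mul_mem _ _ _ _ _ _ := Submodule.mem_top
  decompose' x := DirectSum.of (fun _ : Unit => ((⊤ : Submodule K B) : Type v)) ()
    ⟨x, Submodule.mem_top⟩
  left_inv x := by simp
  right_inv x := by
    induction x using DirectSum.induction_on with
    | zero => simp; exact map_zero (DirectSum.of (fun _ : Unit => (⊤ : Submodule K B)) ())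
    | of i x => simp
    | add x y hx hy =>
      conv_rhs => rw [← hx, ← hy, ← map_add]
      simp

/-- The morphism from a connected double bialgebra to `K[X]`. -/
theorem exists_unique_hom_polynomial {K : Type u} [Field K] [CharZero K] {B : Type v} [Ring B]
    [Bialgebra K B] (D : DoubleBialgebra K B) (hB : IsConnectedCoalgebra K B) :
    ∃ φ : B →ₗ[K] Polynomial K,
      IsDoubleBialgebraHom D.maps (polyMaps K) φ ∧
      (∀ ψ : B →ₗ[K] Polynomial K, IsDoubleBialgebraHom D.maps (polyMaps K) ψ → ψ = φ) ∧
      ∀ x : B, Coalgebra.counit (R := K) x = 0 →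
        {n : ℕ | tensorPowFunctional D.epsDelta.toLinearMap (n + 1)
          (reducedComulIter K B n x) ≠ 0}.Finite ∧
        φ x = ∑ᶠ n : ℕ, tensorPowFunctional D.epsDelta.toLinearMap (n + 1)
          (reducedComulIter K B n x) • hilbertPoly K (n + 1) := by
  -- With a single degree, the grading and homogeneity conditions are vacuous, so the graded theorem
  -- over one letter applies to any connected double bialgebra.
  let 𝒜 : Unit → Submodule K B := fun _ => ⊤
  let _ : GradedAlgebra 𝒜 := trivialGradedAlgebra K B
  have hG : IsGradedCoalgebra 𝒜 := by
    refine ⟨fun a x _ => ?_, fun a ha => absurd rfl ha⟩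
    refine Submodule.mem_iSup_of_mem ((), ()) (Submodule.mem_iSup_of_mem rfl ?_)
    rw [LinearMap.range_eq_top.2 (TensorProduct.map_surjective (fun x => ⟨⟨x, trivial⟩, rfl⟩)
      (fun x => ⟨⟨x, trivial⟩, rfl⟩))]
    trivial
  have hD : D.DeltaCompatible 𝒜 := by
    intro a x _
    rw [LinearMap.range_eq_top.2 (LinearMap.rTensor_surjective _ fun x => ⟨⟨x, trivial⟩, rfl⟩)]
    trivial
  have hinj : Function.Injective (id : Unit → Unit) := Function.injective_id
  have hproj : ∀ x : B, GradedAlgebra.proj 𝒜 () x = x := fun x => by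
    rw [proj_of_mem (m := ()) (by trivial)]
    simp
  obtain ⟨φ, ⟨hφ, -⟩, huniq, hformula⟩ := exists_unique_hom_qsh D hinj hG hD (fun _ _ => rfl)
    (fun m hm => absurd ⟨m, rfl⟩ hm) (hB.isFinitary (letterMap_one D hinj))
  have he := isDoubleBialgebraHom_qshUnitEquiv (K := K)
  refine ⟨(qshUnitEquiv K).toLinearMap ∘ₗ φ, he.comp hφ, fun ψ hψ => ?_, fun x hx => ?_⟩
  · rw [← huniq ((qshUnitEquiv K).symm.toLinearMap ∘ₗ ψ) (he.symm.comp hψ)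
      (fun _ _ _ _ _ => rfl)]
    ext x
    simp
  · obtain ⟨h0, hn⟩ := hformula x hx
    have hcoeff : ∀ n : ℕ, tensorPowFunctional D.epsDelta.toLinearMap (n + 1)
        (reducedComulIter K B n x) = φ x (List.replicate (n + 1) ()) := by
      intro n
      have hid : GradedAlgebra.proj 𝒜 () = LinearMap.id := LinearMap.ext hproj
      have := hn n fun _ => ()
      rw [List.ofFn_const] at this
      rw [this, DoubleBialgebra.gradedCoeff]
      change _ = tensorPowFunctional _ _ (PiTensorProduct.map (fun _ => GradedAlgebra.proj 𝒜 ()) _)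
      rw [hid, PiTensorProduct.map_id]
      rfl
    simp only [hcoeff]
    refine ⟨finite_replicate_ne_zero _, ?_⟩
    rw [LinearMap.comp_apply, LinearEquiv.coe_coe, qshUnitEquiv_apply, h0, map_zero, zero_add]

lemma eq_zero_of_mem_span_one {K : Type u} {B : Type v} [Field K] [Ring B] [Bialgebra K B] {x : B}
    (hx : x ∈ Submodule.span K {(1 : B)}) (h : Coalgebra.counit (R := K) x = 0) : x = 0 := by
  obtain ⟨c, rfl⟩ := Submodule.mem_span_singleton.1 hx
  have : c = 0 := by simpa using h
  rw [this, zero_smul]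

/-- A grading by the nonnegative integers makes the morphism to `QSym` well defined. -/
lemma isFinitary_letterMap_nat {K : Type u} [Field K] {B : Type v} [Ring B]
    [Bialgebra K B] (D : DoubleBialgebra K B) {𝒜 : ℕ → Submodule K B} [GradedAlgebra 𝒜]
    (hG : IsGradedCoalgebra 𝒜) :
    IsFinitary (letterMap D 𝒜 (deg := fun k : ℕ+ => (k : ℕ)) PNat.coe_injective) := by
  refine IsFinitary.of_length fun x => ?_
  -- Letters are at least 1, so length is bounded by degree and long words cannot match the degree
  -- of a given homogeneous element.
  have hlen : ∀ w : List ℕ+, w.length ≤ (w.map fun k : ℕ+ => (k : ℕ)).sum := fun w => by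
    induction w with
    | nil => simp
    | cons a w ih =>
      have := a.pos
      simp only [List.length_cons, List.map_cons, List.sum_cons]
      omega
  induction x using DirectSum.Decomposition.inductionOn 𝒜 with
  | zero => exact ⟨0, by simp⟩
  | @homogeneous i x =>
    refine ⟨i + 1, fun w hw => wordFunctional_letterMap_eq_zero D _ hG w x.2 ?_⟩
    have := hlen w
    omega
  | add x y hx hy =>
    obtain ⟨N, hN⟩ := hx
    obtain ⟨N', hN'⟩ := hy
    refine ⟨max N N', fun w hw => ?_⟩
    rw [map_add, hN w (le_of_max_le_left hw), hN' w (le_of_max_le_right hw), add_zero]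

end DoubleBialg

end

theorem mainTheorem8 {K : Type*} [Field K] [CharZero K]
    {B : Type*} [Ring B] [Bialgebra K B] (D : DoubleBialgebra K B) :
    -- morphisms to `K[X]`
    (IsConnectedCoalgebra K B →
      ∃ φ : B →ₗ[K] Polynomial K,
        IsDoubleBialgebraHom D.maps (polyMaps K) φ ∧
        (∀ ψ : B →ₗ[K] Polynomial K, IsDoubleBialgebraHom D.maps (polyMaps K) ψ → ψ = φ) ∧
        ∀ x : B, Coalgebra.counit (R := K) x = 0 →
          {n : ℕ | tensorPowFunctional D.epsDelta.toLinearMap (n + 1)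
            (reducedComulIter K B n x) ≠ 0}.Finite ∧
          φ x = ∑ᶠ n : ℕ, tensorPowFunctional D.epsDelta.toLinearMap (n + 1)
            (reducedComulIter K B n x) • hilbertPoly K (n + 1)) ∧
    -- `ℕ`-graded connected double bialgebras, morphisms to `QSym`
    (∀ (𝒜 : ℕ → Submodule K B) [GradedAlgebra 𝒜],
      IsGradedCoalgebra 𝒜 → 𝒜 0 = Submodule.span K {1} → D.DeltaCompatible 𝒜 →
      ∃ φ : B →ₗ[K] QSym K,
        (IsDoubleBialgebraHom D.maps (qsymMaps K) φ ∧
          IsHomogeneousHom (fun k : ℕ+ => (k : ℕ)) 𝒜 φ) ∧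
        (∀ ψ : B →ₗ[K] QSym K, IsDoubleBialgebraHom D.maps (qsymMaps K) ψ →
          IsHomogeneousHom (fun k : ℕ+ => (k : ℕ)) 𝒜 ψ → ψ = φ) ∧
        ∀ x : B, Coalgebra.counit (R := K) x = 0 →
          φ x [] = 0 ∧
          ∀ (n : ℕ) (k : Fin (n + 1) → ℕ+),
            φ x (List.ofFn k) = D.gradedCoeff 𝒜 n (fun i => (k i : ℕ)) x) ∧
    -- `Ω` a commutative semigroup, `B` graded by `Ω` with a neutral element `0` adjoined
    (∀ (Ω : Type*) [AddCommSemigroup Ω] [DecidableEq (WithZero Ω)]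
      (𝒜 : WithZero Ω → Submodule K B) [GradedAlgebra 𝒜],
      IsGradedCoalgebra 𝒜 → 𝒜 0 = Submodule.span K {1} → D.DeltaCompatible 𝒜 →
      IsConnectedCoalgebra K B →
      ∃ φ : B →ₗ[K] QSh K Ω,
        (IsDoubleBialgebraHom D.maps (qshMaps K Ω) φ ∧
          IsHomogeneousHom (fun α : Ω => (α : WithZero Ω)) 𝒜 φ) ∧
        (∀ ψ : B →ₗ[K] QSh K Ω, IsDoubleBialgebraHom D.maps (qshMaps K Ω) ψ →
          IsHomogeneousHom (fun α : Ω => (α : WithZero Ω)) 𝒜 ψ → ψ = φ) ∧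
        ∀ x : B, Coalgebra.counit (R := K) x = 0 →
          φ x [] = 0 ∧
          ∀ (n : ℕ) (α : Fin (n + 1) → Ω),
            φ x (List.ofFn α) = D.gradedCoeff 𝒜 n (fun i => (α i : WithZero Ω)) x) ∧
    -- `Ω` a commutative monoid, `B` graded by `Ω` itself
    (∀ (Ω : Type*) [AddCommMonoid Ω] [DecidableEq Ω]
      (𝒜 : Ω → Submodule K B) [GradedAlgebra 𝒜],
      IsGradedCoalgebra 𝒜 → D.DeltaCompatible 𝒜 → IsConnectedCoalgebra K B →
      ∃ φ : B →ₗ[K] QSh K Ω,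
        (IsDoubleBialgebraHom D.maps (qshMaps K Ω) φ ∧ IsHomogeneousHom (fun α : Ω => α) 𝒜 φ) ∧
        (∀ ψ : B →ₗ[K] QSh K Ω, IsDoubleBialgebraHom D.maps (qshMaps K Ω) ψ →
          IsHomogeneousHom (fun α : Ω => α) 𝒜 ψ → ψ = φ) ∧
        ∀ x : B, Coalgebra.counit (R := K) x = 0 →
          φ x [] = 0 ∧
          ∀ (n : ℕ) (α : Fin (n + 1) → Ω),
            φ x (List.ofFn α) = D.gradedCoeff 𝒜 n α x) := by
  refine ⟨exists_unique_hom_polynomial D, ?_, ?_, ?_⟩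
  · intro 𝒜 _ hG h0 hD
    refine exists_unique_hom_qsh D PNat.coe_injective hG hD PNat.add_coe (fun m hm x hx h => ?_)
      (isFinitary_letterMap_nat D hG)
    -- The only degree that is not a letter is 0, where the component K1 meets ker ε_Δ trivially.
    have hm0 : m = 0 := by
      by_contra hne
      exact hm ⟨⟨m, Nat.pos_of_ne_zero hne⟩, rfl⟩
    subst hm0
    exact eq_zero_of_mem_span_one (h0 ▸ hx) h
  · intro Ω _ _ 𝒜 _ hG h0 hD hB
    have hinj : Function.Injective (fun α : Ω => (α : WithZero Ω)) := WithZero.coe_injective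
    refine exists_unique_hom_qsh D hinj hG hD (fun _ _ => rfl) (fun m hm x hx h => ?_)
      (hB.isFinitary (letterMap_one D hinj))
    have hm0 : m = 0 := by
      induction m with
      | zero => rfl
      | coe a => exact absurd ⟨a, rfl⟩ hm
    subst hm0
    exact eq_zero_of_mem_span_one (h0 ▸ hx) h
  · intro Ω _ _ 𝒜 _ hG hD hB
    -- Here the unit of Ω is itself a letter, so every degree is attained and no condition on the
    -- component of degree 0 is needed.
    exact exists_unique_hom_qsh D Function.injective_id hG hD (fun _ _ => rfl)
      (fun m hm => absurd ⟨m, rfl⟩ hm)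
      (hB.isFinitary (letterMap_one D Function.injective_id))
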